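/- **Conventions.** Let $(a_i,A_i)_{1\le i\le p}$ and $(b_j,B_j)_{1\le j\le q}$ be parameters with $a_i,b_j\in\mathbb C$ and $A_i,B_j>0$, let $1\le m\le q$, $0\le n\le p$, and put $$\theta(\xi)=\frac{\prod_{j=1}^m\Gamma(b_j-B_j\xi)\,\prod_{i=1}^n\Gamma(1-a_i+A_i\xi)}{\prod_{j=m+1}^q\Gamma(1-b_j+B_j\xi)\,\prod_{i=n+1}^p\Gamma(a_i-A_i\xi)},\qquad H^{m,n}_{p,q}[z]=\frac1{2\pi i}\int_{L}\theta(\xi)z^\xi\,d\xi .$$ Here $L$ is a line from $c-i\infty$ to $c+i\infty$, or a loop that starts and ends at $+\infty$ (from $+\infty-iT$ to $c-iT$, up to $c+iT$, and back to $+\infty+iT$). It is indented where necessary, so that the poles of the $\Gamma(b_j-B_j\xi)$, $j\le m$, lie to its right and those of the $\Gamma(1-a_i+A_i\xi)$, $i\le n$, to its left. Powers are principal. For $x>a$ put $$(I^{\gamma,\mu}_{a+}f)(x)=\frac{(x-a)^{-\mu-\gamma}}{\Gamma(\mu)}\int_a^x\frac{t^\gamma f(t)}{(x-t)^{1-\mu}}\,dt,\qquad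 (\mathcal H^{w;m,n;\alpha}_{a+;p,q;\beta}f)(x)=\int_a^x(x-t)^{\beta-1}H^{m,n}_{p,q}[w(x-t)^\alpha]f(t)\,dt .$$ **Theorem 2.** Let $\gamma,\mu,\beta\in\mathbb C$ with $\Re\gamma>-1$, $\gamma\notin\{0,1,2,\dots\}$, $\Re\mu>0$, $\Re\beta>0$; let $w\in\mathbb C\setminus\{0\}$, $\alpha>0$, and $\Re\beta+\min_{1\le j\le m}\Re(\alpha b_j/B_j)>0$. Let $a<x$ be real with $x\ne0$ and $\left|\frac{x-u}{x}\right|<1$ for all $u\in(a,x)$. Let $L_1$ be a contour as above for $H^{m,n}_{p,q}$ which also has the poles of $\Gamma(\beta+\alpha\xi)$ on its left and runs in the half-plane $\Re(\beta+\alpha\xi)>0$, and suppose that the integral along $L_1$ which defines $H^{m,n}_{p,q}[ws^\alpha]$ converges absolutely for $0<s\le x-a$. Let $L_2$ be a loop as above, starting and ending at $+\infty$, with the poles $0,1,2,\dots$ of $\Gamma(-\eta)$ on its right and the poles of $\Gamma(-\gamma+\eta)\Gamma(\mu+\eta)$ on its left. Let $\phi:(a,x)\to\mathbb C$ be integrable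 and such that the integral defining $(I^{\gamma,\mu}_{a+}\phi)(x)$ converges absolutely. Then $$\left(I^{\gamma,\mu}_{a+}\mathcal H^{w;m,n;\alpha}_{a+;p,q;\beta}\phi\right)(x)=\frac{x^\gamma(x-a)^{-\mu-\gamma}}{\Gamma(\mu)\Gamma(-\gamma)}\int_a^x(x-u)^{\mu+\beta-1}\,K(u)\,\phi(u)\,du,$$ $$K(u)=H^{0,0:m,n+1;1,2}_{0,1:p+1,q;2,1}\left[\begin{matrix}w(x-u)^\alpha\\[2pt]-\frac{x-u}{x}\end{matrix}\;\middle|\;\begin{matrix}-:(1-\beta,\alpha),(a_i,A_i)_{1,p};(1+\gamma,1),(1-\mu,1)\\(1-\mu-\beta;\alpha,1):(b_j,B_j)_{1,q};(0,1)\end{matrix}\right],$$ where the $H$-function of two variables is the iterated integral $$K(u)=\frac1{(2\pi i)^2}\int_{L_1}\int_{L_2}\frac{\Gamma(\beta+\alpha\xi)\,\theta(\xi)\,\Gamma(-\eta)\Gamma(-\gamma+\eta)\Gamma(\mu+\eta)}{\Gamma(\mu+\beta+\alpha\xi+\eta)}\,\bigl(w(x-u)^\alpha\bigr)^{\xi}\left(-\frac{x-u}{x}\right)^{\eta}d\eta\,d\xi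 .$$ The integral defining $(\mathcal H\phi)(t)$ converges absolutely for almost every $t\in(a,x)$, and the outer integral of the left-hand side, the iterated contour integrals and the $u$-integral on the right converge absolutely. Moreover, for $u\in(a,x)$ and $\Re(\beta+\alpha\xi)>0$, $$\int_u^x t^\gamma(t-u)^{\beta+\alpha\xi-1}(x-t)^{\mu-1}\,dt=x^\gamma(x-u)^{\mu+\beta+\alpha\xi-1}\,B(\mu,\beta+\alpha\xi)\;{}_2F_1\!\left(-\gamma,\mu;\mu+\beta+\alpha\xi;\frac{x-u}{x}\right).$$ -/

import Mathlib

open MeasureTheory Set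

noncomputable section

/-- Orders and parameters of a Fox `H`-function `H^{m,n}_{p,q}`: upper pairs `(a_i, A_i)`,
`i < p`, and lower pairs `(b_j, B_j)`, `j < q` (indices start at `0`). -/
structure HParam (p q : ℕ) where
  m : ℕ
  n : ℕ
  a : Fin p → ℂ
  A : Fin p → ℝ
  b : Fin q → ℂ
  B : Fin q → ℝ

namespace HParam

variable {p q : ℕ}

/-- The Mellin-Barnes density
`∏_{j ≤ m} Γ(b_j - B_j s) ∏_{i ≤ n} Γ(1 - a_i + A_i s) /
  (∏_{j > m} Γ(1 - b_j + B_j s) ∏_{i > n} Γ(a_i - A_i s))`. -/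
def theta (P : HParam p q) (s : ℂ) : ℂ :=
  (∏ j : Fin q, if (j : ℕ) < P.m then Complex.Gamma (P.b j - P.B j * s)
      else (Complex.Gamma (1 - P.b j + P.B j * s))⁻¹) *
  (∏ i : Fin p, if (i : ℕ) < P.n then Complex.Gamma (1 - P.a i + P.A i * s)
      else (Complex.Gamma (P.a i - P.A i * s))⁻¹)

/-- Poles of `Γ(1 - a_i + A_i s)`, `i ≤ n`: they have to lie to the left of the contour. -/
def leftPoles (P : HParam p q) : Set ℂ :=
  {s | ∃ i : Fin p, (i : ℕ) < P.n ∧ ∃ k : ℕ, 1 - P.a i + P.A i * s = -(k : ℂ)}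

/-- Poles of `Γ(b_j - B_j s)`, `j ≤ m`: they have to lie to the right of the contour. -/
def rightPoles (P : HParam p q) : Set ℂ :=
  {s | ∃ j : Fin q, (j : ℕ) < P.m ∧ ∃ k : ℕ, P.b j - P.B j * s = -(k : ℂ)}

/-- Put a new pair `(c, C)` in front of the upper pairs and raise `n` by one:
`H^{m,n}_{p,q}` becomes `H^{m,n+1}_{p+1,q}`. -/
def consUpper (P : HParam p q) (c : ℂ) (C : ℝ) : HParam (p + 1) q where
  m := P.m
  n := P.n + 1
  a := Fin.cons c P.a
  A := Fin.cons C P.A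
  b := P.b
  B := P.B

end HParam

/-- The two kinds of Mellin-Barnes paths: the line from `c - i∞` to `c + i∞`, and the loop
`L_{+∞}` which comes from `+∞ - iT`, runs to `c - iT`, up to `c + iT`, and back to `+∞ + iT`. -/
inductive MBPath where
  | line (c : ℝ) : MBPath
  | loop (c T : ℝ) : MBPath

namespace MBPath

/-- The points of the path. -/
def trace : MBPath → Set ℂ
  | line c => {s | s.re = c}
  | loop c T => {s | (s.re = c ∧ |s.im| ≤ T) ∨ (c ≤ s.re ∧ |s.im| = T)}

/-- The open region to the right of the path. -/
def rightSide : MBPath → Set ℂ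
  | line c => {s | c < s.re}
  | loop c T => {s | c < s.re ∧ |s.im| < T}

/-- The contour integral of `F` along the path. -/
def integral : MBPath → (ℂ → ℂ) → ℂ
  | line c, F => Complex.I * ∫ t : ℝ, F (c + t * Complex.I)
  | loop c T, F =>
      Complex.I * (∫ t in (-T)..T, F (c + t * Complex.I))
        + (∫ s in Ioi c, F (s + T * Complex.I)) - ∫ s in Ioi c, F (s - T * Complex.I)

/-- The contour integral of `F` along the path converges absolutely. -/
def Converges : MBPath → (ℂ → ℂ) → Prop
  | line c, F => Integrable (fun t : ℝ => F (c + t * Complex.I))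
  | loop c T, F =>
      IntegrableOn (fun t : ℝ => F (c + t * Complex.I)) (Icc (-T) T) ∧
      IntegrableOn (fun s : ℝ => F (s + T * Complex.I)) (Ioi c) ∧
      IntegrableOn (fun s : ℝ => F (s - T * Complex.I)) (Ioi c)

end MBPath

/-- A Mellin-Barnes contour: a path, indented so as to leave on its left those (finitely many)
left poles which lie in the region to the right of the path.  The indentation amounts to
a positively oriented circle of radius `r` around each of these poles. -/
structure MBContour where
  path : MBPath
  r : ℝ

namespace MBContour

variable {p q : ℕ}

/-- The left poles around which the path has to be indented. -/
def indented (L : MBContour) (S : Set ℂ) : Set ℂ := S ∩ L.path.rightSide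

/-- All points of the indented contour. -/
def trace (L : MBContour) (S : Set ℂ) : Set ℂ :=
  L.path.trace ∪ ⋃ c ∈ L.indented S, Metric.sphere c L.r

/-- `(2πi)⁻¹ ∫_L F(s) ds`, for the contour indented around the left poles `S`. -/
def mbIntegral (L : MBContour) (S : Set ℂ) (F : ℂ → ℂ) : ℂ :=
  (2 * (Real.pi : ℂ) * Complex.I)⁻¹ *
    (L.path.integral F + ∑ᶠ c ∈ L.indented S, circleIntegral F c L.r)

/-- The integral of `F` along the indented contour converges absolutely. -/
def Converges (L : MBContour) (S : Set ℂ) (F : ℂ → ℂ) : Prop :=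
  L.path.Converges F ∧ ∀ c ∈ L.indented S, CircleIntegrable F c L.r

/-- `L` separates the left poles from the right poles of the density: the right poles lie to the
right of the path, no left pole lies on the path, and the circles around the left poles to the
right of the path stay to the right of it and enclose (and meet) no other pole. -/
def Separates (L : MBContour) (P : HParam p q) : Prop :=
  0 < L.r ∧ L.path.rightSide.Nonempty ∧ P.rightPoles ⊆ L.path.rightSide ∧
  Disjoint P.leftPoles L.path.trace ∧
  ∀ c ∈ L.indented P.leftPoles,
    Metric.closedBall c L.r ⊆ L.path.rightSide ∧
    Metric.closedBall c L.r ∩ P.leftPoles = {c} ∧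
    Disjoint (Metric.closedBall c L.r) P.rightPoles

end MBContour

section FoxH

variable {p q p₁ q₁ p₂ q₂ p₃ q₃ : ℕ}

/-- The integrand `θ(s) z^s` of the `H`-function. -/
def foxIntegrand (P : HParam p q) (z : ℂ) : ℂ → ℂ := fun s => P.theta s * z ^ s

/-- Fox's `H`-function `H^{m,n}_{p,q}[z] = (2πi)⁻¹ ∫_L θ(s) z^s ds`. -/
def foxH (P : HParam p q) (L : MBContour) (z : ℂ) : ℂ :=
  L.mbIntegral P.leftPoles (foxIntegrand P z)

/-- The joint parameters `(c_i; C_i, C'_i)`, `i < p₁`, and `(d_j; D_j, D'_j)`, `j < q₁`, of an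
`H`-function of two variables whose first pair of orders is `0, 0`. -/
structure JointParam (p₁ q₁ : ℕ) where
  c : Fin p₁ → ℂ
  C : Fin p₁ → ℝ
  C' : Fin p₁ → ℝ
  d : Fin q₁ → ℂ
  D : Fin q₁ → ℝ
  D' : Fin q₁ → ℝ

/-- The joint factor
`1 / (∏_i Γ(c_i - C_i ξ - C'_i η) ∏_j Γ(1 - d_j + D_j ξ + D'_j η))`. -/
def JointParam.factor (J : JointParam p₁ q₁) (ξ η : ℂ) : ℂ :=
  (∏ i : Fin p₁, (Complex.Gamma (J.c i - J.C i * ξ - J.C' i * η))⁻¹) *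
  (∏ j : Fin q₁, (Complex.Gamma (1 - J.d j + J.D j * ξ + J.D' j * η))⁻¹)

/-- The integrand of the inner integral (over `η`) of the `H`-function of two variables. -/
def innerIntegrand (J : JointParam p₁ q₁) (P₃ : HParam p₃ q₃) (Y ξ : ℂ) : ℂ → ℂ :=
  fun η => J.factor ξ η * foxIntegrand P₃ Y η

/-- The integrand of the outer integral (over `ξ`) of the `H`-function of two variables. -/
def outerIntegrand (J : JointParam p₁ q₁) (P₂ : HParam p₂ q₂) (P₃ : HParam p₃ q₃)
    (L₂ : MBContour) (X Y : ℂ) : ℂ → ℂ :=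
  fun ξ => foxIntegrand P₂ X ξ * L₂.mbIntegral P₃.leftPoles (innerIntegrand J P₃ Y ξ)

/-- The `H`-function of two variables `H^{0,0:m₂,n₂;m₃,n₃}_{p₁,q₁:p₂,q₂;p₃,q₃}[X, Y]`, that is
`(2πi)⁻² ∫_{L₁} ∫_{L₂} ψ(ξ,η) θ₂(ξ) θ₃(η) X^ξ Y^η dη dξ`. -/
def foxH₂ (J : JointParam p₁ q₁) (P₂ : HParam p₂ q₂) (P₃ : HParam p₃ q₃)
    (L₁ L₂ : MBContour) (X Y : ℂ) : ℂ :=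
  L₁.mbIntegral P₂.leftPoles (outerIntegrand J P₂ P₃ L₂ X Y)

/-- Both integrals in the iterated integral which defines `foxH₂` converge absolutely. -/
def FoxH₂Converges (J : JointParam p₁ q₁) (P₂ : HParam p₂ q₂) (P₃ : HParam p₃ q₃)
    (L₁ L₂ : MBContour) (X Y : ℂ) : Prop :=
  (∀ ξ ∈ L₁.trace P₂.leftPoles, L₂.Converges P₃.leftPoles (innerIntegrand J P₃ Y ξ)) ∧
  L₁.Converges P₂.leftPoles (outerIntegrand J P₂ P₃ L₂ X Y)

/-- The integrand of `(I^{γ,μ}_{a+} f)(x)`. -/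
def fracIntegrand (γ μ : ℂ) (f : ℝ → ℂ) (x t : ℝ) : ℂ :=
  (t : ℂ) ^ γ * f t / ((x - t : ℝ) : ℂ) ^ (1 - μ)

/-- `(I^{γ,μ}_{a+} f)(x) = (x-a)^{-μ-γ} / Γ(μ) ∫_a^x t^γ f(t) / (x-t)^{1-μ} dt`. -/
def fracI (γ μ : ℂ) (a : ℝ) (f : ℝ → ℂ) (x : ℝ) : ℂ :=
  ((x - a : ℝ) : ℂ) ^ (-μ - γ) / Complex.Gamma μ * ∫ t in a..x, fracIntegrand γ μ f x t

/-- The integrand of `(𝓗^{w;m,n;α}_{a+;p,q;β} f)(x)`. -/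
def hOpIntegrand (P : HParam p q) (L : MBContour) (w : ℂ) (α : ℝ) (β : ℂ)
    (f : ℝ → ℂ) (x t : ℝ) : ℂ :=
  ((x - t : ℝ) : ℂ) ^ (β - 1) * foxH P L (w * (((x - t) ^ α : ℝ) : ℂ)) * f t

/-- `(𝓗^{w;m,n;α}_{a+;p,q;β} f)(x) = ∫_a^x (x-t)^{β-1} H^{m,n}_{p,q}[w (x-t)^α] f(t) dt`. -/
def hOp (P : HParam p q) (L : MBContour) (w : ℂ) (α : ℝ) (β : ℂ) (a : ℝ)
    (f : ℝ → ℂ) (x : ℝ) : ℂ :=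
  ∫ t in a..x, hOpIntegrand P L w α β f x t

/-- The joint parameters of the kernel: no upper one, and the lower one `(1 - μ - β; α, 1)`. -/
def kernelJoint (μ β : ℂ) (α : ℝ) : JointParam 0 1 where
  c := Fin.elim0
  C := Fin.elim0
  C' := Fin.elim0
  d := ![1 - μ - β]
  D := ![α]
  D' := ![1]

/-- The parameters of the kernel in the second variable: orders `m = 1`, `n = 2`, upper pairs
`(1 + γ, 1), (1 - μ, 1)` and lower pair `(0, 1)`. -/
def kernelSecond (γ μ : ℂ) : HParam 2 1 where
  m := 1
  n := 2
  a := ![1 + γ, 1 - μ]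
  A := ![1, 1]
  b := ![0]
  B := ![1]

end FoxH

end

/-!
# Composition of a power-weighted fractional integral with an `H`-function operator

Both sides are integrals of one function over the triangle `a < u < t < x` times the contour `L₁`.
An indented contour integral is an integral over a measure space `(Y, ν)` with a bounded weight
(`exists_measure_contour`), so that `s^{β-1} H[w s^α]` is a superposition
`∫ G(y) s^{e(y)-1} dν(y)` of powers, with `e = β + αξ` (`powerKernel`). On the contour
`re e ≥ b > 0` for some `b` (`exists_half_plane`), and convergence at the single point `s = x - a`
bounds this kernel by a multiple of `s^{b-1}`.

*Fubini in `(u, t)`* (`fubini_convolution`). The integrand is dominated by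
`|φ(u)| |t^γ| (x-t)^{re μ-1} (t-u)^{b-1}`. The assumption `|(x-u)/x| < 1` keeps `0` out of the
interval, so `|t^γ|` is at most the sum of its values at `u` and at `x`, and the `t`-integral is at
most a constant times `(|u^γ| + |x^γ|) (x-u)^{re μ+b-1}`. This is integrable against `|φ|` because
`φ` is integrable and the integral defining `(I φ)(x)` converges (`integrableOn_weight`).

*Fubini in `(t, ξ)`* for fixed `u` (`integral_powerKernel`). The inner integral becomes Euler's,
`∫_u^x t^γ (t-u)^{e-1} (x-t)^{μ-1} dt`, which the substitution `t = x - (x-u)τ` turns into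
`x^γ (x-u)^{μ+e-1} ∫₀¹ τ^{μ-1} (1-τ)^{e-1} (1-yτ)^γ dτ` with `y = (x-u)/x`
(`integral_eq_eulerIntegral`). The binomial series, integrated term by term, gives the
hypergeometric series (`hasSum_eulerIntegral`).

*Barnes's integral* (`barnes_loop`, `barnes_mbIntegral`). The loop `L₂` encloses the poles
`0, 1, 2, …` of `Γ(-η)`, and its circles cancel the left poles which it also encloses. By the
residue theorem for the rectangles cut off at `re η = N + 1/2`, the integral over `L₂` is the same
series, up to Gamma factors. No asymptotics of `Γ` are needed for the limit: the recurrence of `Γ`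
shows that the integrand `F` satisfies `‖F(η+1)‖ ≤ ρ ‖F(η)‖` with `ρ < 1` far to the right, and
hence decays geometrically (`exists_norm_barnes_add_one_le`).
-/

noncomputable section

namespace MellinBarnes

open Complex Filter Topology

/-! ### Residues on rectangles and circles -/

/-- `f` has an isolated singularity at `s` with residue `a`: near `s` it is the sum of
`a / (z - s)`, of a function `Q` which has a primitive on `ℂ ∖ {s}` (the rest of the principal
part), and of a function `g` analytic at `s`. -/
def HasResidueAt (f : ℂ → ℂ) (s a : ℂ) : Prop :=
  ∃ R Q g : ℂ → ℂ, (∀ z, z ≠ s → HasDerivAt R (Q z) z) ∧ (∀ z, z ≠ s → DifferentiableAt ℂ Q z) ∧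
    AnalyticAt ℂ g s ∧ ∀ᶠ z in 𝓝[≠] s, f z = a * (z - s)⁻¹ + Q z + g z

/-- At a simple pole, `f = h / (z - s)` has residue `h s`. -/
theorem hasResidueAt_of_simple {f h : ℂ → ℂ} {s : ℂ} (hh : AnalyticAt ℂ h s)
    (hf : ∀ᶠ z in 𝓝[≠] s, f z = (z - s)⁻¹ * h z) : HasResidueAt f s (h s) := by
  refine ⟨0, 0, dslope h s, fun z _ => hasDerivAt_const _ _, fun z _ => differentiableAt_const _,
    ?_, ?_⟩
  · obtain ⟨p, hp⟩ := hh
    exact ⟨_, hp.has_fpower_series_dslope_fslope⟩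
  · filter_upwards [hf, self_mem_nhdsWithin] with z hz hzs
    have hzs' : z - s ≠ 0 := sub_ne_zero.2 hzs
    have := sub_smul_dslope h s z
    rw [smul_eq_mul] at this
    rw [hz, eq_add_of_sub_eq' this.symm]
    simp only [Pi.zero_apply]
    field_simp
    ring

/-- A pole has a residue: its principal part is split off by repeated use of `dslope`, and the
powers `(z - s)^{-n}`, `n ≥ 2`, have primitives. -/
theorem exists_hasResidueAt {f : ℂ → ℂ} {s : ℂ} (hf : MeromorphicAt f s) :
    ∃ a, HasResidueAt f s a := by
  obtain ⟨n, hn⟩ := hf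
  have key : ∀ (n : ℕ) (h : ℂ → ℂ), AnalyticAt ℂ h s →
      ∃ a, HasResidueAt (fun z => ((z - s) ^ n)⁻¹ * h z) s a := by
    intro n
    induction n with
    | zero =>
      intro h hh
      exact ⟨0, 0, 0, h, fun z _ => hasDerivAt_const _ _, fun z _ => differentiableAt_const _, hh,
        Eventually.of_forall fun z => by simp⟩
    | succ n ih =>
      intro h hh
      rcases Nat.eq_zero_or_pos n with rfl | hn
      · exact ⟨h s, hasResidueAt_of_simple hh (Eventually.of_forall fun z => by simp)⟩
      have hd : AnalyticAt ℂ (dslope h s) s := by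
        obtain ⟨p, hp⟩ := hh
        exact ⟨_, hp.has_fpower_series_dslope_fslope⟩
      obtain ⟨a, R, Q, g, hR, hQ, hg, he⟩ := ih _ hd
      have hn' : (n : ℂ) ≠ 0 := by exact_mod_cast hn.ne'
      refine ⟨a, fun z => R z - h s / n * ((z - s) ^ n)⁻¹,
        fun z => Q z + h s * ((z - s) ^ (n + 1))⁻¹, g, ?_, ?_, hg, ?_⟩
      · intro z hz
        have hz' : z - s ≠ 0 := sub_ne_zero.2 hz
        have h1 : HasDerivAt (fun z : ℂ => (z - s) ^ n) (n * (z - s) ^ (n - 1) * 1) z :=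
          ((hasDerivAt_id z).sub_const s).pow n
        have h2 := (h1.inv (pow_ne_zero _ hz')).const_mul (h s / n)
        refine ((hR z hz).sub h2).congr_deriv ?_
        obtain ⟨k, rfl⟩ := Nat.exists_eq_succ_of_ne_zero hn.ne'
        simp only [Nat.succ_eq_add_one, Nat.add_sub_cancel] at *
        field_simp
        ring
      · intro z hz
        have hz' : z - s ≠ 0 := sub_ne_zero.2 hz
        refine (hQ z hz).add (DifferentiableAt.const_mul (DifferentiableAt.inv ?_ ?_) _)
        · fun_prop
        · exact pow_ne_zero _ hz'
      · filter_upwards [he, self_mem_nhdsWithin] with z hz hzs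
        have hzs' : z - s ≠ 0 := sub_ne_zero.2 hzs
        have h1 := sub_smul_dslope h s z
        rw [smul_eq_mul] at h1
        have h2 : h z = h s + (z - s) * dslope h s z := by rw [h1]; ring
        have h3 : ((z - s) ^ (n + 1))⁻¹ * h z
            = h s * ((z - s) ^ (n + 1))⁻¹ + ((z - s) ^ n)⁻¹ * dslope h s z := by
          rw [h2]; field_simp; ring
        rw [h3, hz]; ring
  obtain ⟨a, R, Q, g, hR, hQ, hg, he⟩ := key n _ hn
  refine ⟨a, R, Q, g, hR, hQ, hg, ?_⟩
  filter_upwards [he, self_mem_nhdsWithin] with z hz hzs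
  have hzs' : z - s ≠ 0 := sub_ne_zero.2 hzs
  rw [← hz, smul_eq_mul]
  field_simp

/-- Removing the principal part at `s`: `f` is the sum of the principal part and of a function which
is differentiable at `s`. -/
theorem HasResidueAt.exists_decomp {f : ℂ → ℂ} {s a : ℂ} (h : HasResidueAt f s a) :
    ∃ R Q f₁ : ℂ → ℂ, (∀ z, z ≠ s → HasDerivAt R (Q z) z) ∧
      (∀ z, z ≠ s → DifferentiableAt ℂ Q z) ∧ DifferentiableAt ℂ f₁ s ∧
      ∀ z, z ≠ s → f z = a * (z - s)⁻¹ + Q z + f₁ z := by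
  obtain ⟨R, Q, g, hR, hQ, hg, he⟩ := h
  refine ⟨R, Q, Function.update (fun z => f z - (a * (z - s)⁻¹ + Q z)) s (g s), hR, hQ, ?_, ?_⟩
  · refine hg.differentiableAt.congr_of_eventuallyEq ?_
    rw [eventually_nhdsWithin_iff] at he
    filter_upwards [he] with z hz
    rcases eq_or_ne z s with rfl | hzs
    · simp
    · rw [Function.update_of_ne hzs, hz hzs]; ring
  · intro z hz
    rw [Function.update_of_ne hz]; ring

/-- The residue theorem for a circle around an isolated singularity. -/
theorem HasResidueAt.circleIntegral_eq {f : ℂ → ℂ} {s a : ℂ} (h : HasResidueAt f s a) {r : ℝ}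
    (hr : 0 < r) (hf : ∀ z ∈ Metric.closedBall s r, z ≠ s → DifferentiableAt ℂ f z) :
    circleIntegral f s r = 2 * Real.pi * I * a := by
  obtain ⟨R, Q, f₁, hR, hQ, hf₁, he⟩ := h.exists_decomp
  have hne : ∀ z ∈ Metric.sphere s r, z ≠ s := by
    rintro z hz rfl
    simp at hz
    exact hr.ne hz
  have hf₁' : ∀ z ∈ Metric.closedBall s r, DifferentiableAt ℂ f₁ z := by
    intro z hz
    rcases eq_or_ne z s with rfl | hzs
    · exact hf₁
    have h1 : DifferentiableAt ℂ (fun z => f z - (a * (z - s)⁻¹ + Q z)) z := by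
      have := sub_ne_zero.2 hzs
      have := hf z hz hzs
      have := hQ z hzs
      fun_prop (disch := assumption)
    refine h1.congr_of_eventuallyEq ?_
    filter_upwards [isOpen_ne.mem_nhds hzs] with y hy
    rw [he y hy]; ring
  have hcf₁ : CircleIntegrable f₁ s r :=
    ContinuousOn.circleIntegrable hr.le fun z hz =>
      (hf₁' z (Metric.sphere_subset_closedBall hz)).continuousAt.continuousWithinAt
  have hcQ : CircleIntegrable Q s r :=
    ContinuousOn.circleIntegrable hr.le fun z hz =>
      (hQ z (hne z hz)).continuousAt.continuousWithinAt
  have hci : CircleIntegrable (fun z => a * (z - s)⁻¹) s r := by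
    refine ContinuousOn.circleIntegrable hr.le fun z hz => ?_
    have := sub_ne_zero.2 (hne z hz)
    exact ContinuousAt.continuousWithinAt (by fun_prop (disch := assumption))
  rw [circleIntegral.integral_congr hr.le
    (g := fun z => (a * (z - s)⁻¹ + Q z) + f₁ z) fun z hz => he z (hne z hz),
    circleIntegral.integral_add (f := fun z => a * (z - s)⁻¹ + Q z) (hci.add hcQ) hcf₁,
    circleIntegral.integral_add hci hcQ,
    circleIntegral.integral_const_mul, circleIntegral.integral_sub_center_inv _ hr.ne',
    circleIntegral.integral_eq_zero_of_hasDerivWithinAt hr.le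
      (fun z hz => (hR z (hne z hz)).hasDerivWithinAt),
    circleIntegral_eq_zero_of_differentiable_on_off_countable hr.le countable_empty
      (fun z hz => (hf₁' z hz).continuousAt.continuousWithinAt)
      (fun z hz => hf₁' z (Metric.ball_subset_closedBall hz.1))]
  ring

/-- The integral along the positively oriented boundary of the rectangle `[a, b] × [c, d]`. -/
def rectIntegral (f : ℂ → ℂ) (a b c d : ℝ) : ℂ :=
  (∫ x : ℝ in a..b, f (x + c * I)) - (∫ x : ℝ in a..b, f (x + d * I)) +
    I * (∫ y : ℝ in c..d, f (b + y * I)) - I * (∫ y : ℝ in c..d, f (a + y * I))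

/-- The boundary of the rectangle `[a, b] × [c, d]`. -/
def rectBoundary (a b c d : ℝ) : Set ℂ :=
  {z | (z.re ∈ Icc a b ∧ (z.im = c ∨ z.im = d)) ∨ (z.im ∈ Icc c d ∧ (z.re = a ∨ z.re = b))}

section rect

variable {a b c d : ℝ}

theorem intervalIntegrable_edges (hab : a ≤ b) (hcd : c ≤ d) {f : ℂ → ℂ}
    (hf : ∀ z ∈ rectBoundary a b c d, ContinuousAt f z) :
    IntervalIntegrable (fun x : ℝ => f (x + c * I)) volume a b ∧
    IntervalIntegrable (fun x : ℝ => f (x + d * I)) volume a b ∧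
    IntervalIntegrable (fun y : ℝ => f (b + y * I)) volume c d ∧
    IntervalIntegrable (fun y : ℝ => f (a + y * I)) volume c d := by
  refine ⟨ContinuousOn.intervalIntegrable fun x hx => ContinuousAt.continuousWithinAt ?_,
    ContinuousOn.intervalIntegrable fun x hx => ContinuousAt.continuousWithinAt ?_,
    ContinuousOn.intervalIntegrable fun x hx => ContinuousAt.continuousWithinAt ?_,
    ContinuousOn.intervalIntegrable fun x hx => ContinuousAt.continuousWithinAt ?_⟩
  · rw [uIcc_of_le hab] at hx
    refine ContinuousAt.comp (g := f) (hf _ (Or.inl ?_)) (by fun_prop)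
    simpa using hx
  · rw [uIcc_of_le hab] at hx
    refine ContinuousAt.comp (g := f) (hf _ (Or.inl ?_)) (by fun_prop)
    simpa using hx
  · rw [uIcc_of_le hcd] at hx
    refine ContinuousAt.comp (g := f) (hf _ (Or.inr ?_)) (by fun_prop)
    simpa using hx
  · rw [uIcc_of_le hcd] at hx
    refine ContinuousAt.comp (g := f) (hf _ (Or.inr ?_)) (by fun_prop)
    simpa using hx

theorem rectIntegral_add (hab : a ≤ b) (hcd : c ≤ d) {f g : ℂ → ℂ}
    (hf : ∀ z ∈ rectBoundary a b c d, ContinuousAt f z)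
    (hg : ∀ z ∈ rectBoundary a b c d, ContinuousAt g z) :
    rectIntegral (fun z => f z + g z) a b c d =
      rectIntegral f a b c d + rectIntegral g a b c d := by
  obtain ⟨f1, f2, f3, f4⟩ := intervalIntegrable_edges hab hcd hf
  obtain ⟨g1, g2, g3, g4⟩ := intervalIntegrable_edges hab hcd hg
  simp only [rectIntegral]
  rw [intervalIntegral.integral_add f1 g1, intervalIntegral.integral_add f2 g2,
    intervalIntegral.integral_add f3 g3, intervalIntegral.integral_add f4 g4]
  ring

theorem rectIntegral_const_mul (k : ℂ) (f : ℂ → ℂ) :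
    rectIntegral (fun z => k * f z) a b c d = k * rectIntegral f a b c d := by
  simp only [rectIntegral, intervalIntegral.integral_const_mul]
  ring

theorem rectIntegral_congr (hab : a ≤ b) (hcd : c ≤ d) {f g : ℂ → ℂ}
    (h : ∀ z ∈ rectBoundary a b c d, f z = g z) :
    rectIntegral f a b c d = rectIntegral g a b c d := by
  simp only [rectIntegral]
  have h1 : ∀ x ∈ uIcc a b, f (x + c * I) = g (x + c * I) := fun x hx => by
    rw [uIcc_of_le hab] at hx
    exact h _ (Or.inl (by simpa using hx))
  have h2 : ∀ x ∈ uIcc a b, f (x + d * I) = g (x + d * I) := fun x hx => by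
    rw [uIcc_of_le hab] at hx
    exact h _ (Or.inl (by simpa using hx))
  have h3 : ∀ x ∈ uIcc c d, f (b + x * I) = g (b + x * I) := fun x hx => by
    rw [uIcc_of_le hcd] at hx
    exact h _ (Or.inr (by simpa using hx))
  have h4 : ∀ x ∈ uIcc c d, f (a + x * I) = g (a + x * I) := fun x hx => by
    rw [uIcc_of_le hcd] at hx
    exact h _ (Or.inr (by simpa using hx))
  rw [intervalIntegral.integral_congr h1, intervalIntegral.integral_congr h2,
    intervalIntegral.integral_congr h3, intervalIntegral.integral_congr h4]

theorem integral_horizontal {F f : ℂ → ℂ} {u v k : ℝ}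
    (hF : ∀ x ∈ uIcc u v, HasDerivAt F (f (x + k * I)) ((x : ℂ) + k * I))
    (hf : ∀ x ∈ uIcc u v, ContinuousAt f ((x : ℂ) + k * I)) :
    ∫ x : ℝ in u..v, f (x + k * I) = F (v + k * I) - F (u + k * I) := by
  have := intervalIntegral.integral_eq_sub_of_hasDerivAt (a := u) (b := v)
    (f := fun x : ℝ => F (x + k * I)) (f' := fun x : ℝ => f (x + k * I)) ?_ ?_
  · simpa using this
  · intro x hx
    have h1 : HasDerivAt (fun x : ℝ => (x : ℂ) + k * I) 1 x := (ofRealCLM.hasDerivAt).add_const _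
    simpa [Function.comp_def] using (hF x hx).comp x h1
  · refine ContinuousOn.intervalIntegrable fun x hx => ContinuousAt.continuousWithinAt ?_
    exact ContinuousAt.comp (g := f) (hf x hx) (by fun_prop)

theorem integral_vertical {F f : ℂ → ℂ} {u v k : ℝ}
    (hF : ∀ x ∈ uIcc u v, HasDerivAt F (f (k + x * I)) ((k : ℂ) + x * I))
    (hf : ∀ x ∈ uIcc u v, ContinuousAt f ((k : ℂ) + x * I)) :
    I * ∫ x : ℝ in u..v, f (k + x * I) = F (k + v * I) - F (k + u * I) := by
  rw [← intervalIntegral.integral_const_mul]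
  have := intervalIntegral.integral_eq_sub_of_hasDerivAt (a := u) (b := v)
    (f := fun x : ℝ => F (k + x * I)) (f' := fun x : ℝ => I * f (k + x * I)) ?_ ?_
  · simpa using this
  · intro x hx
    have h1 : HasDerivAt (fun x : ℝ => (k : ℂ) + x * I) I x := by
      simpa using ((ofRealCLM.hasDerivAt (x := x)).mul_const I).const_add (k : ℂ)
    rw [mul_comm]
    exact (hF x hx).comp x h1
  · refine ContinuousOn.intervalIntegrable fun x hx => ContinuousAt.continuousWithinAt ?_
    exact continuousAt_const.mul (ContinuousAt.comp (g := f) (hf x hx) (by fun_prop))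

theorem rectIntegral_eq_zero_of_hasDerivAt (hab : a ≤ b) (hcd : c ≤ d) {R Q : ℂ → ℂ}
    (hR : ∀ z ∈ rectBoundary a b c d, HasDerivAt R (Q z) z)
    (hQ : ∀ z ∈ rectBoundary a b c d, ContinuousAt Q z) :
    rectIntegral Q a b c d = 0 := by
  have h1 : ∀ x ∈ uIcc a b, (x : ℂ) + c * I ∈ rectBoundary a b c d := fun x hx => by
    rw [uIcc_of_le hab] at hx
    exact (Or.inl (by simpa using hx))
  have h2 : ∀ x ∈ uIcc a b, (x : ℂ) + d * I ∈ rectBoundary a b c d := fun x hx => by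
    rw [uIcc_of_le hab] at hx
    exact (Or.inl (by simpa using hx))
  have h3 : ∀ x ∈ uIcc c d, (b : ℂ) + x * I ∈ rectBoundary a b c d := fun x hx => by
    rw [uIcc_of_le hcd] at hx
    exact (Or.inr (by simpa using hx))
  have h4 : ∀ x ∈ uIcc c d, (a : ℂ) + x * I ∈ rectBoundary a b c d := fun x hx => by
    rw [uIcc_of_le hcd] at hx
    exact (Or.inr (by simpa using hx))
  rw [rectIntegral,
    integral_horizontal (F := R) (fun x hx => hR _ (h1 x hx)) (fun x hx => hQ _ (h1 x hx)),
    integral_horizontal (F := R) (fun x hx => hR _ (h2 x hx)) (fun x hx => hQ _ (h2 x hx)),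
    integral_vertical (F := R) (fun x hx => hR _ (h3 x hx)) (fun x hx => hQ _ (h3 x hx)),
    integral_vertical (F := R) (fun x hx => hR _ (h4 x hx)) (fun x hx => hQ _ (h4 x hx))]
  ring

theorem rectIntegral_inv (ha : a < 0) (hb : 0 < b) (hc : c < 0) (hd : 0 < d) :
    rectIntegral (fun z => z⁻¹) a b c d = 2 * Real.pi * I := by
  -- `log` is a primitive on three sides; on the left one, which crosses the cut, `log (-z)` is
  have hlog : ∀ z ∈ slitPlane, HasDerivAt Complex.log z⁻¹ z := fun z hz => Complex.hasDerivAt_log hz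
  have hlog' : ∀ z, -z ∈ slitPlane → HasDerivAt (fun z => Complex.log (-z)) z⁻¹ z := fun z hz => by
    simpa using (hasDerivAt_neg z).clog hz
  have hinv : ∀ z ∈ slitPlane, ContinuousAt (fun z : ℂ => z⁻¹) z := fun z hz =>
    continuousAt_inv₀ (slitPlane_ne_zero hz)
  have hinv' : ∀ z, -z ∈ slitPlane → ContinuousAt (fun z : ℂ => z⁻¹) z := fun z hz =>
    continuousAt_inv₀ (neg_ne_zero.1 (slitPlane_ne_zero hz))
  have h1 : ∀ x : ℝ, (x : ℂ) + c * I ∈ slitPlane := fun x => Or.inr (by simpa using hc.ne)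
  have h2 : ∀ x : ℝ, (x : ℂ) + d * I ∈ slitPlane := fun x => Or.inr (by simpa using hd.ne')
  have h3 : ∀ x : ℝ, (b : ℂ) + x * I ∈ slitPlane := fun x => Or.inl (by simpa using hb)
  have h4 : ∀ x : ℝ, -((a : ℂ) + x * I) ∈ slitPlane := fun x => Or.inl (by simpa using ha)
  rw [rectIntegral,
    integral_horizontal (f := fun z => z⁻¹) (fun x _ => hlog _ (h1 x)) (fun x _ => hinv _ (h1 x)),
    integral_horizontal (f := fun z => z⁻¹) (fun x _ => hlog _ (h2 x)) (fun x _ => hinv _ (h2 x)),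
    integral_vertical (f := fun z => z⁻¹) (fun x _ => hlog _ (h3 x)) (fun x _ => hinv _ (h3 x)),
    integral_vertical (f := fun z => z⁻¹) (fun x _ => hlog' _ (h4 x)) (fun x _ => hinv' _ (h4 x))]
  have e1 : Complex.log (-((a : ℂ) + d * I)) = Complex.log (a + d * I) - Real.pi * I := by
    simp only [Complex.log, norm_neg]
    rw [arg_neg_eq_arg_sub_pi_of_im_pos (by simpa using hd)]
    push_cast; ring
  have e2 : Complex.log (-((a : ℂ) + c * I)) = Complex.log (a + c * I) + Real.pi * I := by
    simp only [Complex.log, norm_neg]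
    rw [arg_neg_eq_arg_add_pi_of_im_neg (by simpa using hc)]
    push_cast; ring
  rw [e1, e2]
  ring

theorem rectIntegral_sub_inv {s : ℂ} (hs : s.re ∈ Ioo a b) (hs' : s.im ∈ Ioo c d) :
    rectIntegral (fun z => (z - s)⁻¹) a b c d = 2 * Real.pi * I := by
  rw [← rectIntegral_inv (sub_neg.2 hs.1) (sub_pos.2 hs.2) (sub_neg.2 hs'.1) (sub_pos.2 hs'.2)]
  have hs0 : s = s.re + s.im * I := (re_add_im s).symm
  simp only [rectIntegral]
  rw [← intervalIntegral.integral_comp_sub_right (fun x : ℝ => ((x : ℂ) + (c - s.im : ℝ) * I)⁻¹),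
    ← intervalIntegral.integral_comp_sub_right (fun x : ℝ => ((x : ℂ) + (d - s.im : ℝ) * I)⁻¹),
    ← intervalIntegral.integral_comp_sub_right (fun x : ℝ => ((b - s.re : ℝ) + (x : ℂ) * I)⁻¹),
    ← intervalIntegral.integral_comp_sub_right (fun x : ℝ => ((a - s.re : ℝ) + (x : ℂ) * I)⁻¹)]
  have e : ∀ x y : ℝ, (x : ℂ) + y * I - s = ((x - s.re : ℝ) : ℂ) + ((y - s.im : ℝ) : ℂ) * I := by
    intro x y
    conv_lhs => rw [hs0]
    push_cast; ring
  simp only [e]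

/-- The residue theorem for a rectangle. -/
theorem rectIntegral_eq_sum_residues (hab : a < b) (hcd : c < d) (S : Finset ℂ) (A : ℂ → ℂ) :
    ∀ f : ℂ → ℂ, (∀ s ∈ S, s.re ∈ Ioo a b ∧ s.im ∈ Ioo c d) → (∀ s ∈ S, HasResidueAt f s (A s)) →
    (∀ z : ℂ, z.re ∈ Icc a b → z.im ∈ Icc c d → z ∉ S → DifferentiableAt ℂ f z) →
    rectIntegral f a b c d = 2 * Real.pi * I * ∑ s ∈ S, A s := by
  induction S using Finset.induction_on with
  | empty =>
    intro f _ _ hf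
    have := integral_boundary_rect_eq_zero_of_differentiableOn f (⟨a, c⟩ : ℂ) (⟨b, d⟩ : ℂ) ?_
    · simpa [rectIntegral] using this
    · intro z hz
      simp only [uIcc_of_le hab.le, uIcc_of_le hcd.le] at hz
      exact (hf z hz.1 hz.2 (by simp)).differentiableWithinAt
  | insert s S hsS ih =>
    intro f hS hA hf
    obtain ⟨R, Q, f₁, hR, hQ, hf₁, he⟩ := (hA s (by simp)).exists_decomp
    have hs := hS s (by simp)
    -- the subtracted principal part is differentiable away from `s`
    have hP : ∀ z, z ≠ s → DifferentiableAt ℂ (fun z => A s * (z - s)⁻¹ + Q z) z := by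
      intro z hz
      have := sub_ne_zero.2 hz
      have := hQ z hz
      fun_prop (disch := assumption)
    have hev : ∀ z, z ≠ s → f₁ =ᶠ[𝓝 z] fun z => f z - (A s * (z - s)⁻¹ + Q z) := by
      intro z hz
      filter_upwards [isOpen_ne.mem_nhds hz] with y hy
      rw [he y hy]; ring
    have hd₁ : ∀ z : ℂ, z.re ∈ Icc a b → z.im ∈ Icc c d → z ∉ S → DifferentiableAt ℂ f₁ z := by
      intro z h1 h2 h3
      rcases eq_or_ne z s with rfl | hzs
      · exact hf₁
      exact ((hf z h1 h2 (by simp [hzs, h3])).sub (hP z hzs)).congr_of_eventuallyEq (hev z hzs)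
    have hA₁ : ∀ t ∈ S, HasResidueAt f₁ t (A t) := by
      intro t ht
      have hts : t ≠ s := fun h => hsS (h ▸ ht)
      obtain ⟨R', Q', g', hR', hQ', hg', he'⟩ := hA t (by simp [ht])
      refine ⟨R', Q', fun z => g' z - (A s * (z - s)⁻¹ + Q z), hR', hQ', hg'.sub ?_, ?_⟩
      · rw [Complex.analyticAt_iff_eventually_differentiableAt]
        filter_upwards [isOpen_ne.mem_nhds hts] with y hy using hP y hy
      · filter_upwards [he', (hev t hts).filter_mono nhdsWithin_le_nhds] with z h1 h2
        rw [h2, h1]; ring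
    have hb : ∀ z ∈ rectBoundary a b c d, z.re ∈ Icc a b ∧ z.im ∈ Icc c d ∧ z ≠ s ∧ z ∉ S := by
      have : ∀ t, t.re ∈ Ioo a b ∧ t.im ∈ Ioo c d → t ∉ rectBoundary a b c d := by
        rintro t ⟨⟨h1, h2⟩, h3, h4⟩ (⟨-, h | h⟩ | ⟨-, h | h⟩)
        exacts [h3.ne' h, h4.ne h, h1.ne' h, h2.ne h]
      intro z hz
      refine ⟨?_, ?_, fun h => this z (h ▸ hs) hz, fun h => this z (hS z (by simp [h])) hz⟩
      · rcases hz with h | ⟨-, h | h⟩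
        exacts [h.1, ⟨h.ge, h.le.trans hab.le⟩, ⟨hab.le.trans h.ge, h.le⟩]
      · rcases hz with ⟨-, h | h⟩ | h
        exacts [⟨h.ge, h.le.trans hcd.le⟩, ⟨hcd.le.trans h.ge, h.le⟩, h.1]
    have hci : ∀ z ∈ rectBoundary a b c d, ContinuousAt (fun z => A s * (z - s)⁻¹) z := by
      intro z hz
      have := sub_ne_zero.2 (hb z hz).2.2.1
      fun_prop (disch := assumption)
    have hcQ : ∀ z ∈ rectBoundary a b c d, ContinuousAt Q z := fun z hz =>
      (hQ z (hb z hz).2.2.1).continuousAt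
    rw [Finset.sum_insert hsS,
      rectIntegral_congr hab.le hcd.le (g := fun z => (A s * (z - s)⁻¹ + Q z) + f₁ z)
        (fun z hz => he z (hb z hz).2.2.1),
      rectIntegral_add hab.le hcd.le (f := fun z => A s * (z - s)⁻¹ + Q z)
        (fun z hz => (hci z hz).add (hcQ z hz))
        (fun z hz => (hd₁ z (hb z hz).1 (hb z hz).2.1 (hb z hz).2.2.2).continuousAt),
      rectIntegral_add hab.le hcd.le hci hcQ,
      rectIntegral_eq_zero_of_hasDerivAt hab.le hcd.le (fun z hz => hR z (hb z hz).2.2.1) hcQ,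
      rectIntegral_const_mul, rectIntegral_sub_inv hs.1 hs.2,
      ih f₁ (fun t ht => hS t (by simp [ht])) hA₁ hd₁]
    ring

end rect

/-! ### Sums of residues as loop integrals -/

/-- The residue theorem for the loop: if the integrals over the segments `re z = N + 1/2` tend to
zero, the loop integral is `-2πi` times the sum of the residues at `0, 1, 2, …` and at the
finitely many other singularities `S`. The sign reflects that the loop runs clockwise around
its inside. -/
theorem tendsto_sum_residues_loop {F : ℂ → ℂ} {c T : ℝ} (hT : 0 < T) (hc : c < 0) (S : Finset ℂ)
    (A : ℂ → ℂ) (R : ℕ → ℂ) (hS : ∀ s ∈ S, c < s.re ∧ |s.im| < T)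
    (hA : ∀ s ∈ S, HasResidueAt F s (A s)) (hR : ∀ k : ℕ, HasResidueAt F k (R k))
    (hSk : ∀ k : ℕ, (k : ℂ) ∉ S)
    (hd : ∀ z : ℂ, c ≤ z.re → |z.im| ≤ T → z ∉ S → (∀ k : ℕ, z ≠ k) → DifferentiableAt ℂ F z)
    (hconv : (MBPath.loop c T).Converges F)
    (hv : Tendsto (fun N : ℕ => ∫ t in (-T)..T, F (((N + 1 / 2 : ℝ) : ℂ) + t * I)) atTop (𝓝 0)) :
    Tendsto (fun N : ℕ => 2 * Real.pi * I * (∑ k ∈ Finset.range (N + 1), R k + ∑ s ∈ S, A s)) atTop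
      (𝓝 (-(MBPath.loop c T).integral F)) := by
  have hx : Tendsto (fun N : ℕ => (N + 1 / 2 : ℝ)) atTop atTop :=
    tendsto_atTop_add_const_right _ _ tendsto_natCast_atTop_atTop
  have hb := intervalIntegral_tendsto_integral_Ioi c hconv.2.2 hx
  have ht := intervalIntegral_tendsto_integral_Ioi c hconv.2.1 hx
  have hlim := ((hb.sub ht).add (hv.const_mul I)).sub_const
    (I * ∫ t in (-T)..T, F (c + t * I))
  have hlim' : -(MBPath.loop c T).integral F
      = (∫ s in Ioi c, F (s - T * I)) - (∫ s in Ioi c, F (s + T * I)) + I * 0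
        - I * ∫ t in (-T)..T, F (c + t * I) := by
    simp only [MBPath.integral]; ring
  rw [hlim']
  refine hlim.congr' ?_
  have hbig : ∀ᶠ N : ℕ in atTop, ∀ s ∈ S, s.re < N + 1 / 2 := by
    rw [Filter.eventually_all_finset]
    intro s _
    exact hx.eventually_gt_atTop s.re
  filter_upwards [hbig] with N hN
  classical
  -- both families of residues as one function of the singularity
  set A' : ℂ → ℂ := fun s => if s ∈ S then A s else R ⌊s.re⌋₊ with hA'
  have hinj : Function.Injective (fun k : ℕ => (k : ℂ)) := Nat.cast_injective
  have hA'k : ∀ k : ℕ, A' k = R k := by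
    intro k
    simp [hA', hSk k]
  set S' : Finset ℂ := S ∪ (Finset.range (N + 1)).image (fun k : ℕ => (k : ℂ)) with hS'
  have hdisj : Disjoint S ((Finset.range (N + 1)).image (fun k : ℕ => (k : ℂ))) := by
    rw [Finset.disjoint_right]
    intro s hs
    obtain ⟨k, -, rfl⟩ := Finset.mem_image.1 hs
    exact hSk k
  have hsum : ∑ s ∈ S', A' s = ∑ k ∈ Finset.range (N + 1), R k + ∑ s ∈ S, A s := by
    rw [hS', Finset.sum_union hdisj, Finset.sum_image (fun _ _ _ _ h => hinj h), add_comm]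
    congr 1
    · exact Finset.sum_congr rfl fun k _ => hA'k k
    · exact Finset.sum_congr rfl fun s hs => by simp [hA', hs]
  have hN0 : (0 : ℝ) ≤ N := Nat.cast_nonneg N
  have key := rectIntegral_eq_sum_residues (a := c) (b := N + 1 / 2) (c := -T) (d := T)
    (by linarith) (by linarith) S' A' F ?_ ?_ ?_
  · rw [← hsum, ← key, rectIntegral]
    have e : ∀ x : ℝ, (x : ℂ) + ((-T : ℝ) : ℂ) * I = x - T * I := fun x => by push_cast; ring
    simp only [e]
  · intro s hs
    rcases Finset.mem_union.1 hs with hs | hs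
    · exact ⟨⟨(hS s hs).1, hN s hs⟩, abs_lt.1 (hS s hs).2⟩
    · obtain ⟨k, hk, rfl⟩ := Finset.mem_image.1 hs
      have hk' : (k : ℝ) ≤ N := by
        exact_mod_cast Nat.lt_succ_iff.1 (Finset.mem_range.1 hk)
      have hk0 : (0 : ℝ) ≤ k := Nat.cast_nonneg k
      simp only [natCast_re, natCast_im]
      exact ⟨⟨by linarith, by linarith⟩, by linarith, hT⟩
  · intro s hs
    rcases Finset.mem_union.1 hs with hs | hs
    · simpa [hA', hs] using hA s hs
    · obtain ⟨k, hk, rfl⟩ := Finset.mem_image.1 hs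
      simpa only [hA'k] using hR k
  · intro z hz1 hz2 hz3
    refine hd z hz1.1 (abs_le.2 hz2) (fun h => hz3 (Finset.mem_union_left _ h)) ?_
    rintro k rfl
    refine hz3 (Finset.mem_union_right _ (Finset.mem_image.2 ⟨k, Finset.mem_range.2 ?_, rfl⟩))
    have h1 := hz1.2
    simp only [natCast_re] at h1
    have h2 : (k : ℝ) < (N + 1 : ℕ) := by push_cast; linarith
    exact_mod_cast h2

/-- A function with `‖F (z + 1)‖ ≤ ρ ‖F z‖`, `ρ < 1`, far to the right is integrable along
horizontal rays. -/
theorem integrableOn_ray {f : ℝ → ℂ} {c R ρ : ℝ} (hρ : 0 < ρ) (hρ1 : ρ < 1)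
    (hf : ContinuousOn f (Ici c)) (hrec : ∀ t, R ≤ t → ‖f (t + 1)‖ ≤ ρ * ‖f t‖) :
    IntegrableOn f (Ioi c) := by
  wlog hcR : c ≤ R generalizing R
  · exact this (R := c) (fun t ht => hrec t (by linarith)) le_rfl
  obtain ⟨C, hC⟩ := (isCompact_Icc (a := R) (b := R + 1)).exists_bound_of_continuousOn
    (hf.mono fun t ht => hcR.trans ht.1)
  have hpow : ∀ n : ℕ, ∀ t ∈ Icc R (R + 1), ‖f (t + n)‖ ≤ ρ ^ n * C := by
    intro n
    induction n with
    | zero => intro t ht; simpa using hC t ht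
    | succ n ih =>
      intro t ht
      have h1 := hrec (t + n) (by have := ht.1; have : (0 : ℝ) ≤ n := n.cast_nonneg; linarith)
      push_cast
      rw [← add_assoc]
      calc ‖f (t + n + 1)‖ ≤ ρ * ‖f (t + n)‖ := h1
        _ ≤ ρ * (ρ ^ n * C) := by gcongr; exact ih t ht
        _ = ρ ^ (n + 1) * C := by ring
  have hC0 : 0 ≤ C := (norm_nonneg _).trans (hC R ⟨le_rfl, by linarith⟩)
  have hbd : ∀ t ∈ Ioi R,
      ‖f t‖ ≤ C * ρ⁻¹ * Real.exp (-Real.log ρ * R) * Real.exp (Real.log ρ * t) := by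
    intro t ht
    have ht' : R < t := ht
    set n := ⌊t - R⌋₊ with hn
    have h1 : (n : ℝ) ≤ t - R := Nat.floor_le (by linarith)
    have h2 : t - R < n + 1 := Nat.lt_floor_add_one _
    have h3 := hpow n (t - n) ⟨by linarith, by linarith⟩
    rw [sub_add_cancel] at h3
    refine h3.trans ?_
    have h4 : ρ ^ n ≤ ρ⁻¹ * Real.exp (Real.log ρ * (t - R)) := by
      rw [← Real.rpow_def_of_pos hρ, ← Real.rpow_natCast, ← Real.rpow_neg_one, ← Real.rpow_add hρ]
      exact Real.rpow_le_rpow_of_exponent_ge hρ hρ1.le (by linarith)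
    calc ρ ^ n * C ≤ (ρ⁻¹ * Real.exp (Real.log ρ * (t - R))) * C := by gcongr
      _ = _ := by
        rw [show Real.log ρ * (t - R) = -Real.log ρ * R + Real.log ρ * t by ring, Real.exp_add]
        ring
  rw [← Ioc_union_Ioi_eq_Ioi hcR]
  refine IntegrableOn.union ?_ ?_
  · exact ((hf.mono Icc_subset_Ici_self).integrableOn_Icc).mono_set Ioc_subset_Icc_self
  · refine Integrable.mono' ((integrableOn_exp_mul_Ioi (Real.log_neg hρ hρ1) R).const_mul
        (C * ρ⁻¹ * Real.exp (-Real.log ρ * R)))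
      ((hf.mono fun t ht => hcR.trans (le_of_lt ht)).aestronglyMeasurable measurableSet_Ioi) ?_
    exact (ae_restrict_iff' measurableSet_Ioi).2 (Eventually.of_forall hbd)

/-! ### The Mellin-Barnes integral of the hypergeometric function -/

/-- The Barnes integrand `Γ(-η) Γ(-γ+η) Γ(μ+η) / Γ(e+η) Y^η` of the hypergeometric function. -/
def barnes (γ μ e Y η : ℂ) : ℂ :=
  (Gamma (e + η))⁻¹ * (Gamma (-η) * (Gamma (-γ + η) * Gamma (μ + η)) * Y ^ η)

/-- The inner integrand depends on `ξ` only through `e = μ + β + αξ`. -/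
theorem innerIntegrand_eq_barnes (γ μ β Y ξ : ℂ) (α : ℝ) :
    innerIntegrand (kernelJoint μ β α) (kernelSecond γ μ) Y ξ
      = barnes γ μ (μ + β + α * ξ) Y := by
  funext η
  have e1 : (1 : ℂ) - (1 - μ - β) + α * ξ + η = μ + β + α * ξ + η := by ring
  simp [innerIntegrand, foxIntegrand, HParam.theta, JointParam.factor, kernelJoint, kernelSecond,
    barnes, Fin.prod_univ_two, e1]

theorem mem_leftPoles_kernelSecond {γ μ s : ℂ} :
    s ∈ (kernelSecond γ μ).leftPoles ↔
      ∃ k : ℕ, -γ + s = -(k : ℂ) ∨ μ + s = -(k : ℂ) := by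
  simp [HParam.leftPoles, kernelSecond, Fin.exists_fin_two, exists_or]

theorem mem_rightPoles_kernelSecond {γ μ s : ℂ} :
    s ∈ (kernelSecond γ μ).rightPoles ↔ ∃ k : ℕ, s = k := by
  simp [HParam.rightPoles, kernelSecond]

section barnes

variable {γ μ e Y : ℂ}

theorem differentiableAt_barnes (hY : Y ≠ 0) {z : ℂ} (h1 : z ∉ (kernelSecond γ μ).leftPoles)
    (h2 : ∀ k : ℕ, z ≠ k) : DifferentiableAt ℂ (barnes γ μ e Y) z := by
  rw [mem_leftPoles_kernelSecond] at h1
  push Not at h1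
  have d1 : DifferentiableAt ℂ (fun z => (Gamma (e + z))⁻¹) z :=
    (differentiable_one_div_Gamma (e + z)).comp z (by fun_prop)
  have d2 : DifferentiableAt ℂ (fun z => Gamma (-z)) z :=
    (differentiableAt_Gamma (-z) fun m h => h2 m (neg_injective h)).comp z (by fun_prop)
  have d3 : DifferentiableAt ℂ (fun z => Gamma (-γ + z)) z :=
    (differentiableAt_Gamma (-γ + z) fun m => (h1 m).1).comp z (by fun_prop)
  have d4 : DifferentiableAt ℂ (fun z => Gamma (μ + z)) z :=
    (differentiableAt_Gamma (μ + z) fun m => (h1 m).2).comp z (by fun_prop)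
  have d5 : DifferentiableAt ℂ (fun z : ℂ => Y ^ z) z :=
    differentiableAt_id.const_cpow (Or.inl hY)
  exact d1.mul ((d2.mul (d3.mul d4)).mul d5)

theorem meromorphicAt_barnes (hY : Y ≠ 0) (z : ℂ) : MeromorphicAt (barnes γ μ e Y) z := by
  have hG : ∀ f : ℂ → ℂ, Differentiable ℂ f → MeromorphicAt (fun z => (Gamma (f z))⁻¹) z :=
    fun f hf => ((differentiable_one_div_Gamma.comp hf).analyticAt z).meromorphicAt
  have hG' : ∀ f : ℂ → ℂ, Differentiable ℂ f → MeromorphicAt (fun z => Gamma (f z)) z := by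
    intro f hf
    have := (hG f hf).inv
    simpa [Pi.inv_def] using this
  have hp : Differentiable ℂ (fun z : ℂ => Y ^ z) := fun z =>
    differentiableAt_id.const_cpow (Or.inl hY)
  exact (hG _ (by fun_prop)).mul (((hG' _ (by fun_prop)).mul
    ((hG' _ (by fun_prop)).mul (hG' _ (by fun_prop)))).mul (hp.analyticAt z).meromorphicAt)

/-- At `η = k` only `Γ(-η)` has a pole, with residue `-(-1)^k / k!`. It is made explicit by
`Γ(-η) = Γ(k+1-η) / ((-η) (1-η) ⋯ (k-η))`. -/
theorem barnes_hasResidueAt_nat (hμ : 0 < μ.re) (hγ : ∀ k : ℕ, γ ≠ k) (hY : Y ≠ 0) (k : ℕ) :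
    HasResidueAt (barnes γ μ e Y) k
      (-((-1) ^ k / k.factorial * (Gamma (-γ + k) * Gamma (μ + k) / Gamma (e + k)) * Y ^ k)) := by
  -- `h z` is `(z - k)` times the integrand, with the pole of `Γ(-z)` at `k` cancelled
  set h : ℂ → ℂ := fun z => -(Gamma (-z + (k + 1 : ℕ)) * ((ascPochhammer ℂ k).eval (-z))⁻¹) *
    ((Gamma (e + z))⁻¹ * (Gamma (-γ + z) * Gamma (μ + z)) * Y ^ z) with hh
  have hasc : (ascPochhammer ℂ k).eval (-(k : ℂ)) = (-1) ^ k * k.factorial := by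
    rw [ascPochhammer_eval_neg_eq_descPochhammer, descPochhammer_eval_eq_descFactorial,
      Nat.descFactorial_self]
  have hasc0 : (ascPochhammer ℂ k).eval (-(k : ℂ)) ≠ 0 := by
    rw [hasc]
    exact mul_ne_zero (pow_ne_zero _ (by norm_num)) (by exact_mod_cast k.factorial_ne_zero)
  have hval : h k = -((-1) ^ k / k.factorial * (Gamma (-γ + k) * Gamma (μ + k) / Gamma (e + k))
      * Y ^ k) := by
    have e1 : -(k : ℂ) + ((k + 1 : ℕ) : ℂ) = 1 := by push_cast; ring
    simp only [hh, hasc, e1, Gamma_one, cpow_natCast, mul_inv, ← inv_pow]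
    norm_num
    ring
  have h1 : ∀ᶠ z : ℂ in 𝓝 (k : ℂ), 0 < (-z + ((k + 1 : ℕ) : ℂ)).re := by
    have hc : ContinuousAt (fun z : ℂ => (-z + ((k + 1 : ℕ) : ℂ)).re) k := by fun_prop
    filter_upwards [hc.eventually_const_lt (u := 0) (by simp)] with z hz
    exact hz
  have hcont : Continuous fun z : ℂ => (ascPochhammer ℂ k).eval (-z) :=
    (ascPochhammer ℂ k).continuous.comp continuous_neg
  have h2 : ∀ᶠ z : ℂ in 𝓝 (k : ℂ), (ascPochhammer ℂ k).eval (-z) ≠ 0 :=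
    hcont.continuousAt.eventually_ne hasc0
  -- near `k` the other Gamma functions of the numerator have no poles
  have h3 : ∀ᶠ z : ℂ in 𝓝 (k : ℂ), z ∈ Metric.ball (k : ℂ) 1 ∧ 0 < (μ + z).re := by
    have hc : ContinuousAt (fun z : ℂ => (μ + z).re) k := by fun_prop
    have hk : (0 : ℝ) ≤ k := k.cast_nonneg
    exact Filter.Eventually.and (Metric.ball_mem_nhds _ one_pos)
      (hc.eventually_const_lt (u := 0) (by simp; linarith))
  have h4 : ∀ m : ℕ, -γ + k ≠ -m := by
    intro m hm
    refine hγ (k + m) ?_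
    push_cast
    linear_combination -hm
  have hγan : AnalyticAt ℂ (fun z => Gamma (-γ + z)) k := by
    have : AnalyticAt ℂ (fun z => ((Gamma (-γ + z))⁻¹)⁻¹) k := by
      refine AnalyticAt.inv ?_ (inv_ne_zero (Gamma_ne_zero h4))
      exact Differentiable.analyticAt (differentiable_one_div_Gamma.comp
        (f := fun z => -γ + z) (by fun_prop)) _
    simpa using this
  have hpos : ∀ s : ℂ, 0 < s.re → ∀ m : ℕ, s ≠ -m := by
    rintro s hs m rfl
    simp at hs
    have : (0 : ℝ) ≤ m := m.cast_nonneg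
    linarith
  have han : AnalyticAt ℂ h k := by
    have a1 : AnalyticAt ℂ (fun z : ℂ => Gamma (-z + (k + 1 : ℕ))) k := by
      rw [analyticAt_iff_eventually_differentiableAt]
      filter_upwards [h1] with z hz
      exact (differentiableAt_Gamma _ (hpos _ hz)).comp z (by fun_prop)
    have a2 : AnalyticAt ℂ (fun z : ℂ => ((ascPochhammer ℂ k).eval (-z))⁻¹) k := by
      refine AnalyticAt.inv (Differentiable.analyticAt ?_ _) hasc0
      exact (ascPochhammer ℂ k).differentiable.comp differentiable_neg
    have a3 : AnalyticAt ℂ (fun z : ℂ => (Gamma (e + z))⁻¹) k :=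
      Differentiable.analyticAt (differentiable_one_div_Gamma.comp
        (f := fun z => e + z) (by fun_prop)) _
    have a4 : AnalyticAt ℂ (fun z : ℂ => Gamma (μ + z)) k := by
      rw [analyticAt_iff_eventually_differentiableAt]
      filter_upwards [h3] with z hz
      exact (differentiableAt_Gamma _ (hpos _ hz.2)).comp z (by fun_prop)
    have a5 : AnalyticAt ℂ (fun z : ℂ => Y ^ z) k :=
      Differentiable.analyticAt (fun z => differentiableAt_id.const_cpow (Or.inl hY)) _
    exact ((a1.mul a2).neg).mul ((a3.mul (hγan.mul a4)).mul a5)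
  rw [← hval]
  refine hasResidueAt_of_simple han ?_
  filter_upwards [h1.filter_mono nhdsWithin_le_nhds, h2.filter_mono nhdsWithin_le_nhds,
    h3.filter_mono nhdsWithin_le_nhds, self_mem_nhdsWithin] with z hz1 hz2 hz3 hz4
  have hzk : z - k ≠ 0 := sub_ne_zero.2 hz4
  have hzm : ∀ m : ℕ, -z ≠ -m := by
    intro m hm
    have hm' : z = m := neg_injective hm
    subst hm'
    have h5 := hz3.1
    rw [Metric.mem_ball, dist_eq_norm, ← Int.cast_natCast, ← Int.cast_natCast (n := k),
      ← Int.cast_sub, Complex.norm_intCast] at h5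
    have h6 : (m : ℤ) - k = 0 := by
      rw [← Int.abs_lt_one_iff]
      exact_mod_cast h5
    apply hzk
    exact_mod_cast congrArg (Int.cast : ℤ → ℂ) h6
  have hG := Gamma_add_nat_div_Gamma_eq (n := k + 1) (-z) hzm
  rw [ascPochhammer_succ_eval] at hG
  have hG0 : Gamma (-z) ≠ 0 := Gamma_ne_zero hzm
  have hne : -z + k ≠ 0 := by
    intro h
    apply hzk
    linear_combination -h
  rw [div_eq_iff hG0] at hG
  simp only [hh, barnes, hG]
  field_simp
  ring

/-- The recurrence of `Γ` gives a recurrence with rational coefficients for the integrand. -/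
theorem barnes_add_one (hY : Y ≠ 0) {z : ℂ} (h1 : e + z ≠ 0) (h2 : z + 1 ≠ 0) (h3 : -γ + z ≠ 0)
    (h4 : μ + z ≠ 0) :
    barnes γ μ e Y (z + 1)
      = -((-γ + z) * (μ + z) / ((z + 1) * (e + z)) * Y) * barnes γ μ e Y z := by
  have g2 : Gamma (-z) = -(z + 1) * Gamma (-(z + 1)) := by
    rw [← Gamma_add_one _ (neg_ne_zero.2 h2)]; ring_nf
  simp only [barnes, ← add_assoc]
  rw [g2, Gamma_add_one _ h1, Gamma_add_one _ h3, Gamma_add_one _ h4, cpow_add _ _ hY, cpow_one]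
  field_simp

/-- The factor of the recurrence tends to `-Y` as `re z → ∞`, uniformly in `im z`; hence the
integrand decays geometrically to the right. -/
theorem exists_norm_barnes_add_one_le (γ μ e : ℂ) (hY : Y ≠ 0) (hY1 : ‖Y‖ < 1) :
    ∃ ρ R : ℝ, 0 < ρ ∧ ρ < 1 ∧ ∀ z : ℂ, R ≤ z.re →
      ‖barnes γ μ e Y (z + 1)‖ ≤ ρ * ‖barnes γ μ e Y z‖ := by
  obtain ⟨ρ, hρ, hρ1⟩ := exists_between hY1
  have hρ0 : 0 < ρ := (norm_nonneg _).trans_lt hρ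
  -- each quotient `(z + u) / (z + v)` has modulus at most `1 + ‖u - v‖ / (re z - ‖v‖)`
  have hq : ∀ u v z : ℂ, ‖v‖ < z.re → ‖(u + z) / (v + z)‖ ≤ 1 + ‖u - v‖ / (z.re - ‖v‖) := by
    intro u v z hz
    have h1 : z.re - ‖v‖ ≤ ‖v + z‖ := by
      have h2 := Complex.re_le_norm (v + z)
      have h3 := Complex.abs_re_le_norm v
      have h4 := (abs_le.1 h3).1
      rw [add_re] at h2
      linarith
    have h0 : 0 < z.re - ‖v‖ := by linarith
    have h5 : v + z ≠ 0 := norm_pos_iff.1 (h0.trans_le h1)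
    have h6 : (u + z) / (v + z) = 1 + (u - v) / (v + z) := by field_simp; ring
    rw [h6]
    refine (norm_add_le _ _).trans ?_
    rw [norm_one, norm_div]
    gcongr
  have hlim : Tendsto (fun r : ℝ => (1 + ‖-γ - 1‖ / (r - ‖(1 : ℂ)‖)) * (1 + ‖μ - e‖ / (r - ‖e‖))
      * ‖Y‖) atTop (𝓝 ((1 + 0) * (1 + 0) * ‖Y‖)) := by
    refine ((tendsto_const_nhds.add ?_).mul (tendsto_const_nhds.add ?_)).mul_const _
    · exact tendsto_const_nhds.div_atTop (tendsto_atTop_add_const_right _ (-‖(1 : ℂ)‖) tendsto_id)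
    · exact tendsto_const_nhds.div_atTop (tendsto_atTop_add_const_right _ (-‖e‖) tendsto_id)
  have hev := (hlim.eventually_lt_const (u := ρ) (by simpa using hρ)).and
    ((eventually_gt_atTop (‖γ‖ + ‖μ‖ + ‖e‖ + 1)))
  obtain ⟨R, hR⟩ := eventually_atTop.1 hev
  refine ⟨ρ, R, hρ0, hρ1, fun z hz => ?_⟩
  obtain ⟨hz1, hz2⟩ := hR z.re hz
  have hne : ∀ v : ℂ, ‖v‖ < z.re → v + z ≠ 0 := by
    intro v hv h
    have : z = -v := by linear_combination h
    have h2 := Complex.re_le_norm z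
    rw [this, norm_neg, ← this] at h2
    linarith
  have p1 := norm_nonneg γ
  have p2 := norm_nonneg μ
  have p3 := norm_nonneg e
  have he : ‖e‖ < z.re := by linarith
  have h1 : ‖(1 : ℂ)‖ < z.re := by rw [norm_one]; linarith
  rw [barnes_add_one hY (hne e he) (by rw [add_comm]; exact hne 1 h1)
    (hne _ (by rw [norm_neg]; linarith)) (hne μ (by linarith)), norm_mul, norm_neg, norm_mul]
  refine mul_le_mul_of_nonneg_right (le_trans ?_ hz1.le) (norm_nonneg _)
  refine mul_le_mul_of_nonneg_right ?_ (norm_nonneg _)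
  rw [mul_div_mul_comm, norm_mul, add_comm z 1]
  refine mul_le_mul (hq _ _ _ h1) (hq _ _ _ he) (norm_nonneg _) ?_
  have : 0 < z.re - ‖(1 : ℂ)‖ := by linarith
  positivity

/-- Path and region lie in a half-plane whose boundary line meets the path on the real axis. -/
theorem exists_re_bound (p : MBPath) : ∃ c : ℝ, (p.rightSide.Nonempty → (c : ℂ) ∈ p.trace) ∧
    (∀ s ∈ p.trace, c ≤ s.re) ∧ ∀ s ∈ p.rightSide, c < s.re := by
  cases p with
  | line c => exact ⟨c, fun _ => ofReal_re c, fun s hs => hs.ge, fun s hs => hs⟩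
  | loop c T =>
    refine ⟨c, fun ⟨z, hz⟩ => Or.inl ⟨ofReal_re c, ?_⟩, ?_, fun s hs => hs.1⟩
    · rw [ofReal_im, abs_zero]
      exact (abs_nonneg _).trans hz.2.le
    · rintro s (hs | hs)
      exacts [hs.1.ge, hs.1]

/-- Only finitely many left poles have to be avoided by indenting the path. -/
theorem indented_finite {p q : ℕ} (P : HParam p q) (hA : ∀ i, 0 < P.A i) (L : MBContour) :
    (L.indented P.leftPoles).Finite := by
  obtain ⟨c, -, -, hc⟩ := exists_re_bound L.path
  have hfin : (⋃ i : Fin p, (fun k : ℕ => (P.a i - 1 - k) / (P.A i : ℂ)) ''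
      {k : ℕ | (k : ℝ) ≤ (P.a i).re - 1 - c * P.A i}).Finite := by
    refine Set.finite_iUnion fun i => Set.Finite.image _ ?_
    refine (Set.finite_Iic ⌊(P.a i).re - 1 - c * P.A i⌋₊).subset fun k hk => ?_
    exact Nat.le_floor hk
  refine hfin.subset ?_
  rintro s ⟨⟨i, -, k, hk⟩, hs⟩
  have hAi : (P.A i : ℂ) ≠ 0 := by exact_mod_cast (hA i).ne'
  refine mem_iUnion.2 ⟨i, k, ?_, ?_⟩
  · have h1 := congrArg Complex.re hk
    simp at h1
    have h2 := mul_lt_mul_of_pos_right (hc s hs) (hA i)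
    show (k : ℝ) ≤ _
    linarith
  · simp only
    rw [div_eq_iff hAi]
    linear_combination -hk

/-- On the disc bounded by a circle of the indentation, its centre is the only pole. -/
theorem notMem_poles_of_mem_closedBall {p q : ℕ} {P : HParam p q} {L : MBContour}
    (hL : L.Separates P) {s : ℂ} (hs : s ∈ L.indented P.leftPoles) {z : ℂ}
    (hz : z ∈ Metric.closedBall s L.r) (hzs : z ≠ s) : z ∉ P.leftPoles ∧ z ∉ P.rightPoles := by
  obtain ⟨-, -, -, -, h⟩ := hL
  obtain ⟨-, h2, h3⟩ := h s hs
  refine ⟨fun h' => ?_, fun h' => disjoint_left.1 h3 hz h'⟩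
  have : z ∈ Metric.closedBall s L.r ∩ P.leftPoles := ⟨hz, h'⟩
  rw [h2] at this
  exact hzs this

/-- The Barnes loop integral exists, and it is the sum of the residues at `0, 1, 2, …`: the circles
of the indented contour cancel the contributions of the left poles inside the loop. -/
theorem barnes_loop {L : MBContour} (hL : L.Separates (kernelSecond γ μ)) {c T : ℝ}
    (hp : L.path = MBPath.loop c T) (hμ : 0 < μ.re) (hγ : ∀ k : ℕ, γ ≠ k) (hY : Y ≠ 0)
    (hY1 : ‖Y‖ < 1) :
    L.Converges (kernelSecond γ μ).leftPoles (barnes γ μ e Y) ∧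
    Tendsto (fun N : ℕ => ∑ k ∈ Finset.range (N + 1),
      (-1) ^ k / k.factorial * (Gamma (-γ + k) * Gamma (μ + k) / Gamma (e + k)) * Y ^ k) atTop
      (𝓝 (L.mbIntegral (kernelSecond γ μ).leftPoles (barnes γ μ e Y))) := by
  have hsph := fun s hs z hz hzs => notMem_poles_of_mem_closedBall hL (s := s) hs (z := z) hz hzs
  obtain ⟨hr, hne, hright, hleft, hcirc⟩ := id hL
  rw [hp] at hne hright hleft
  have hT : 0 < T := by
    obtain ⟨z, -, hz⟩ := hne
    exact (abs_nonneg _).trans_lt hz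
  have hc : c < 0 := by
    have : (0 : ℂ) ∈ (MBPath.loop c T).rightSide :=
      hright (mem_rightPoles_kernelSecond.2 ⟨0, by simp⟩)
    exact this.1
  have hfin : (L.indented (kernelSecond γ μ).leftPoles).Finite :=
    indented_finite _ (fun i => by fin_cases i <;> simp [kernelSecond]) L
  -- the path avoids all poles
  have htr : ∀ z ∈ (MBPath.loop c T).trace, DifferentiableAt ℂ (barnes γ μ e Y) z := by
    intro z hz
    refine differentiableAt_barnes hY (fun h => disjoint_left.1 hleft h hz) ?_
    rintro k rfl
    have hk : (0 : ℝ) ≤ k := k.cast_nonneg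
    rcases hz with ⟨h, -⟩ | ⟨-, h⟩
    · simp at h
      linarith
    · simp at h
      linarith
  have hsph' : ∀ s ∈ L.indented (kernelSecond γ μ).leftPoles, ∀ z ∈ Metric.closedBall s L.r,
      z ≠ s → DifferentiableAt ℂ (barnes γ μ e Y) z := by
    intro s hs z hz hzs
    obtain ⟨h1, h2⟩ := hsph s hs z hz hzs
    exact differentiableAt_barnes hY h1 fun k hk => h2 (mem_rightPoles_kernelSecond.2 ⟨k, hk⟩)
  obtain ⟨ρ, R, hρ, hρ1, hrec⟩ := exists_norm_barnes_add_one_le γ μ e hY hY1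
  have hray : ∀ k : ℝ, |k| = T →
      IntegrableOn (fun s : ℝ => barnes γ μ e Y (s + k * I)) (Ioi c) := by
    intro k hk
    refine integrableOn_ray (R := R) hρ hρ1 ?_ ?_
    · intro t ht
      refine ContinuousAt.continuousWithinAt (ContinuousAt.comp (g := barnes γ μ e Y)
        (htr _ (Or.inr ?_)).continuousAt (by fun_prop))
      simpa [hk] using ht
    · intro t ht
      have := hrec (t + k * I) (by simpa using ht)
      rwa [show (t : ℂ) + k * I + 1 = ((t + 1 : ℝ) : ℂ) + k * I by push_cast; ring] at this
  have hpath : (MBPath.loop c T).Converges (barnes γ μ e Y) := by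
    refine ⟨?_, hray T (abs_of_pos hT), ?_⟩
    · refine ContinuousOn.integrableOn_Icc fun t ht => ContinuousAt.continuousWithinAt ?_
      refine ContinuousAt.comp (g := barnes γ μ e Y) (htr _ (Or.inl ?_)).continuousAt (by fun_prop)
      simpa using abs_le.2 ht
    · have h := hray (-T) (by rw [abs_neg, abs_of_pos hT])
      have e1 : ∀ s : ℝ, (s : ℂ) + ((-T : ℝ) : ℂ) * I = s - T * I := fun s => by push_cast; ring
      simpa only [e1] using h
  refine ⟨⟨hp ▸ hpath, fun s hs => ?_⟩, ?_⟩
  · refine ContinuousOn.circleIntegrable hr.le fun z hz => ?_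
    refine (hsph' s hs z (Metric.sphere_subset_closedBall hz) ?_).continuousAt.continuousWithinAt
    rintro rfl
    simp at hz
    exact hr.ne hz
  -- the integrals along the vertical segments `re z = N + 1 / 2` tend to zero
  have hv : Tendsto (fun N : ℕ => ∫ t in (-T)..T, barnes γ μ e Y (((N + 1 / 2 : ℝ) : ℂ) + t * I))
      atTop (𝓝 0) := by
    -- to the right of `N₀` the recurrence bound holds and there are no left poles
    obtain ⟨N₀, hN₀⟩ : ∃ N₀ : ℕ, R ≤ N₀ ∧ ∀ s ∈ L.indented (kernelSecond γ μ).leftPoles,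
        s.re < N₀ := by
      have h1 : ∀ᶠ N : ℕ in atTop, ∀ s ∈ hfin.toFinset, s.re < N := by
        rw [Filter.eventually_all_finset]
        exact fun s _ => tendsto_natCast_atTop_atTop.eventually_gt_atTop s.re
      obtain ⟨N, hN1, hN2⟩ := ((tendsto_natCast_atTop_atTop.eventually_ge_atTop R).and h1).exists
      exact ⟨N, hN1, fun s hs => hN2 s (hfin.mem_toFinset.2 hs)⟩
    have hcont : ContinuousOn (fun t : ℝ => barnes γ μ e Y (((N₀ + 1 / 2 : ℝ) : ℂ) + t * I))
        (Icc (-T) T) := by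
      intro t ht
      have hN00 : (0 : ℝ) ≤ N₀ := N₀.cast_nonneg
      refine ContinuousAt.continuousWithinAt (ContinuousAt.comp (g := barnes γ μ e Y) ?_
        (by fun_prop))
      by_cases hTt : |t| = T
      · refine (htr _ (Or.inr ?_)).continuousAt
        constructor
        · simp; linarith
        · simpa using hTt
      have hlt : |t| < T := lt_of_le_of_ne (abs_le.2 ht) hTt
      refine (differentiableAt_barnes hY (fun h => ?_) fun k hk => ?_).continuousAt
      · have h2 := hN₀.2 _ ⟨h, hp ▸ ⟨by simp; linarith, by simpa using hlt⟩⟩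
        simp at h2
        linarith
      · have h2 := congrArg Complex.re hk
        simp at h2
        have h3 : (2 * N₀ + 1 : ℝ) = 2 * k := by linarith
        have h4 : 2 * N₀ + 1 = 2 * k := by exact_mod_cast h3
        omega
    obtain ⟨C, hC⟩ := (isCompact_Icc (a := -T) (b := T)).exists_bound_of_continuousOn hcont
    have hpow : ∀ n : ℕ, ∀ t ∈ Icc (-T) T,
        ‖barnes γ μ e Y ((((N₀ + n : ℕ) + 1 / 2 : ℝ) : ℂ) + t * I)‖ ≤ C * ρ ^ n := by
      intro n
      induction n with
      | zero => intro t ht; simpa using hC t ht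
      | succ n ih =>
        intro t ht
        have h1 := hrec ((((N₀ + n : ℕ) + 1 / 2 : ℝ) : ℂ) + t * I) (by
          have h2 : (0 : ℝ) ≤ n := n.cast_nonneg
          have h3 := hN₀.1
          simp
          linarith)
        have h4 : (((N₀ + (n + 1) : ℕ) + 1 / 2 : ℝ) : ℂ) + t * I
            = (((N₀ + n : ℕ) + 1 / 2 : ℝ) : ℂ) + t * I + 1 := by push_cast; ring
        rw [h4]
        calc _ ≤ _ := h1
          _ ≤ ρ * (C * ρ ^ n) := by gcongr; exact ih t ht
          _ = _ := by ring
    rw [← tendsto_add_atTop_iff_nat N₀]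
    refine squeeze_zero_norm (a := fun n : ℕ => C * ρ ^ n * |T - -T|) (fun n => ?_) ?_
    · refine intervalIntegral.norm_integral_le_of_norm_le_const fun t ht => ?_
      rw [add_comm n]
      rw [uIoc_of_le (by linarith)] at ht
      exact hpow n t (Ioc_subset_Icc_self ht)
    · have := ((tendsto_pow_atTop_nhds_zero_of_lt_one hρ.le hρ1).const_mul C).mul_const |T - -T|
      simpa using this
  choose A hA using fun s : ℂ => exists_hasResidueAt
    (meromorphicAt_barnes (γ := γ) (μ := μ) (e := e) hY s)
  have key := tendsto_sum_residues_loop hT hc hfin.toFinset A _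
    (fun s hs => by
      have := ((hfin.mem_toFinset).1 hs).2
      rwa [hp] at this)
    (fun s _ => hA s) (fun k => barnes_hasResidueAt_nat (e := e) hμ hγ hY k)
    (fun k hk => by
      have h1 := (hfin.mem_toFinset).1 hk
      have h2 := (hcirc _ h1).2.2
      exact disjoint_left.1 h2 (Metric.mem_closedBall_self hr.le)
        (mem_rightPoles_kernelSecond.2 ⟨k, rfl⟩))
    (fun z h1 h2 h3 h4 => by
      refine differentiableAt_barnes hY (fun h => ?_) h4
      by_cases hz : z ∈ (MBPath.loop c T).trace
      · exact disjoint_left.1 hleft h hz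
      · refine h3 (hfin.mem_toFinset.2 ⟨h, ?_⟩)
        rw [hp]
        refine ⟨lt_of_le_of_ne h1 fun h' => hz (Or.inl ⟨h'.symm, h2⟩),
          lt_of_le_of_ne h2 fun h' => hz (Or.inr ⟨h1, h'⟩)⟩)
    hpath hv
  have hpi : (2 * (Real.pi : ℂ) * I) ≠ 0 := by
    simp [Real.pi_ne_zero]
  have hmb : L.mbIntegral (kernelSecond γ μ).leftPoles (barnes γ μ e Y)
      = -((2 * (Real.pi : ℂ) * I)⁻¹ * -(MBPath.loop c T).integral (barnes γ μ e Y)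
          - ∑ s ∈ hfin.toFinset, A s) := by
    rw [MBContour.mbIntegral, finsum_mem_eq_finite_toFinset_sum _ hfin, hp,
      Finset.sum_congr rfl (g := fun s => 2 * (Real.pi : ℂ) * I * A s) fun s hs =>
        (hA s).circleIntegral_eq hr (hsph' s (hfin.mem_toFinset.1 hs)), ← Finset.mul_sum]
    field_simp
    ring
  rw [hmb]
  refine (((key.const_mul (2 * (Real.pi : ℂ) * I)⁻¹).sub_const
    (∑ s ∈ hfin.toFinset, A s)).neg).congr fun N => ?_
  rw [inv_mul_cancel_left₀ hpi, add_sub_cancel_right, Finset.sum_neg_distrib, neg_neg]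

end barnes

/-! ### Euler's integral for the hypergeometric function -/

theorem ofReal_mul_cpow {r : ℝ} (hr : 0 < r) (z s : ℂ) :
    ((r : ℂ) * z) ^ s = (r : ℂ) ^ s * z ^ s := by
  have hr' : (r : ℂ) ≠ 0 := by exact_mod_cast hr.ne'
  rcases eq_or_ne z 0 with rfl | hz
  · rcases eq_or_ne s 0 with rfl | hs
    · simp
    · simp [zero_cpow hs]
  rw [cpow_def_of_ne_zero (mul_ne_zero hr' hz), cpow_def_of_ne_zero hr', cpow_def_of_ne_zero hz,
    log_ofReal_mul hr hz, ofReal_log hr.le, add_mul, exp_add]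

/-- The binomial series, with Pochhammer symbols as coefficients. -/
theorem hasSum_one_sub_cpow (γ : ℂ) {v : ℂ} (hv : ‖v‖ < 1) :
    HasSum (fun n : ℕ => (ascPochhammer ℂ n).eval (-γ) / n.factorial * v ^ n) ((1 - v) ^ γ) := by
  have h := (one_add_cpow_hasFPowerSeriesOnBall_zero (a := γ)).hasSum (y := -v) (by
    rw [Metric.mem_eball, edist_zero_right, enorm_neg, ← ofReal_norm]
    exact ENNReal.ofReal_lt_one.2 hv)
  rw [binomialSeries_eq_ordinaryHypergeometricSeries (b := (1 : ℂ)) (fun k hk => by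
    have := congrArg Complex.re hk
    simp at this
    have : (0 : ℝ) ≤ k := k.cast_nonneg
    linarith)] at h
  have e : (1 : ℂ) + (0 + -v) = 1 - v := by ring
  simp only [e] at h
  refine h.congr_fun fun n => ?_
  have h1 : (ascPochhammer ℂ n).eval 1 ≠ 0 := by
    rw [ascPochhammer_eval_one]
    exact_mod_cast n.factorial_ne_zero
  have h2 : ((-ContinuousLinearMap.id ℂ ℂ : ℂ →L[ℂ] ℂ) : ℂ → ℂ) ∘ (fun _ : Fin n => -v)
      = fun _ => v := by
    funext i
    simp
  rw [FormalMultilinearSeries.compContinuousLinearMap_apply, h2,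
    ordinaryHypergeometricSeries_apply_eq, smul_eq_mul]
  field_simp

/-- Euler's integral `∫₀¹ τ^{μ-1} (1-τ)^{b-1} (1-yτ)^γ dτ`. -/
def eulerIntegral (γ μ b : ℂ) (y : ℝ) : ℂ :=
  ∫ τ in (0 : ℝ)..1, (τ : ℂ) ^ (μ - 1) * (1 - (τ : ℂ)) ^ (b - 1) * (1 - (y : ℂ) * τ) ^ γ

/-- Euler's integral is the termwise integral of the binomial series of `(1-yτ)^γ`. -/
theorem hasSum_eulerIntegral (γ : ℂ) {μ b : ℂ} {y : ℝ} (hμ : 0 < μ.re) (hb : 0 < b.re)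
    (hy : |y| < 1) :
    HasSum (fun n : ℕ => (ascPochhammer ℂ n).eval (-γ) / n.factorial * (y : ℂ) ^ n *
      betaIntegral (μ + n) b) (eulerIntegral γ μ b y) := by
  have hβ := fun n : ℕ => betaIntegral_convergent (u := μ + n) (v := b)
    (by simp; have : (0 : ℝ) ≤ n := n.cast_nonneg; linarith) hb
  simp only [intervalIntegrable_iff_integrableOn_Ioc_of_le zero_le_one] at hβ
  set F : ℕ → ℝ → ℂ := fun n τ => (ascPochhammer ℂ n).eval (-γ) / n.factorial * (y : ℂ) ^ n *
    ((τ : ℂ) ^ (μ + n - 1) * (1 - (τ : ℂ)) ^ (b - 1)) with hF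
  have hint : ∀ n, Integrable (F n) (volume.restrict (Ioc 0 1)) := fun n => (hβ n).const_mul _
  have hfac : ∀ n : ℕ, ∀ τ ∈ Ioc (0 : ℝ) 1, F n τ =
      ((τ : ℂ) ^ (μ - 1) * (1 - (τ : ℂ)) ^ (b - 1)) *
      ((ascPochhammer ℂ n).eval (-γ) / n.factorial * ((y : ℂ) * τ) ^ n) := by
    intro n τ hτ
    have hτ0 : (τ : ℂ) ≠ 0 := by exact_mod_cast hτ.1.ne'
    rw [hF]
    simp only
    rw [show μ + n - 1 = (μ - 1) + n by ring, cpow_add _ _ hτ0, cpow_natCast, mul_pow]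
    ring
  have hsum : Summable fun n => ∫ τ in Ioc (0 : ℝ) 1, ‖F n τ‖ := by
    have h1 : Summable fun n : ℕ => ‖(ascPochhammer ℂ n).eval (-γ) / n.factorial * (y : ℂ) ^ n‖ :=
      (hasSum_one_sub_cpow γ (v := y) (by simpa using hy)).summable.norm
    refine Summable.of_nonneg_of_le (fun n => integral_nonneg fun τ => norm_nonneg _) (fun n => ?_)
      (h1.mul_right (∫ τ in Ioc (0 : ℝ) 1, ‖(τ : ℂ) ^ (μ - 1) * (1 - (τ : ℂ)) ^ (b - 1)‖))
    rw [← integral_const_mul]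
    refine setIntegral_mono_on (hint n).norm ?_ measurableSet_Ioc fun τ hτ => ?_
    · have := (hβ 0).norm.const_mul ‖(ascPochhammer ℂ n).eval (-γ) / n.factorial * (y : ℂ) ^ n‖
      simpa [IntegrableOn] using this
    · rw [hfac n τ hτ, norm_mul, mul_comm, norm_mul _ (((y : ℂ) * τ) ^ n), norm_mul _ ((y : ℂ) ^ n),
        norm_pow, norm_pow, norm_mul]
      have h2 : ‖(τ : ℂ)‖ ≤ 1 := by
        rw [norm_real, Real.norm_of_nonneg hτ.1.le]; exact hτ.2
      gcongr
      exact mul_le_of_le_one_right (norm_nonneg _) h2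
  have key := hasSum_integral_of_summable_integral_norm hint hsum
  have e1 : ∫ τ in Ioc (0 : ℝ) 1, ∑' n, F n τ = eulerIntegral γ μ b y := by
    rw [eulerIntegral, intervalIntegral.integral_of_le zero_le_one]
    refine setIntegral_congr_fun measurableSet_Ioc fun τ hτ => ?_
    have hv : ‖(y : ℂ) * τ‖ < 1 := by
      rw [norm_mul, norm_real, norm_real, Real.norm_eq_abs, Real.norm_eq_abs, abs_of_pos hτ.1]
      calc |y| * τ ≤ |y| * 1 := by gcongr; exact hτ.2
        _ < 1 := by simpa using hy
    simp only [fun n => hfac n τ hτ]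
    rw [tsum_mul_left, (hasSum_one_sub_cpow γ hv).tsum_eq]
  rw [e1] at key
  refine key.congr_fun fun n => ?_
  simp only [hF]
  rw [betaIntegral, intervalIntegral.integral_of_le zero_le_one, integral_const_mul]

theorem eulerIntegral_eq_hypergeometric (γ : ℂ) {μ b : ℂ} {y : ℝ} (hμ : 0 < μ.re) (hb : 0 < b.re)
    (hy : |y| < 1) :
    eulerIntegral γ μ b y = betaIntegral μ b * ordinaryHypergeometric (-γ) μ (μ + b) (y : ℂ) := by
  have hpos : ∀ s : ℂ, 0 < s.re → ∀ m : ℕ, s ≠ -m := by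
    rintro s hs m rfl
    simp at hs
    have : (0 : ℝ) ≤ m := m.cast_nonneg
    linarith
  have hμb : 0 < (μ + b).re := by rw [add_re]; linarith
  rw [← (hasSum_eulerIntegral γ hμ hb hy).tsum_eq, ordinaryHypergeometric_eq_tsum, ← tsum_mul_left]
  refine tsum_congr fun n => ?_
  have hn : (0 : ℝ) ≤ n := n.cast_nonneg
  have hμn : 0 < (μ + n).re := by simp; linarith
  have hg1 := Gamma_ne_zero_of_re_pos hμ
  have hg2 := Gamma_ne_zero_of_re_pos hμb
  have hg3 : Gamma (μ + b + n) ≠ 0 := Gamma_ne_zero_of_re_pos (by rw [add_re]; simp at *; linarith)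
  rw [betaIntegral_eq_Gamma_mul_div _ _ hμ hb, betaIntegral_eq_Gamma_mul_div _ _ hμn hb,
    ← Gamma_add_nat_div_Gamma_eq μ (hpos _ hμ), ← Gamma_add_nat_div_Gamma_eq (μ + b) (hpos _ hμb),
    smul_eq_mul, show μ + n + b = μ + b + n by ring]
  field_simp

/-- Barnes's representation of the hypergeometric function, through Euler's integral. -/
theorem barnes_mbIntegral {γ μ b : ℂ} {y : ℝ} {L : MBContour}
    (hL : L.Separates (kernelSecond γ μ)) (hp : ∃ c T : ℝ, L.path = MBPath.loop c T)
    (hμ : 0 < μ.re) (hb : 0 < b.re) (hγ : ∀ k : ℕ, γ ≠ k) (hy0 : y ≠ 0) (hy : |y| < 1) :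
    Gamma b * L.mbIntegral (kernelSecond γ μ).leftPoles (barnes γ μ (μ + b) ((-y : ℝ) : ℂ))
      = Gamma (-γ) * eulerIntegral γ μ b y := by
  obtain ⟨c, T, hp⟩ := hp
  have h1 := (barnes_loop (e := μ + b) hL hp hμ hγ (Y := ((-y : ℝ) : ℂ))
    (by exact_mod_cast neg_ne_zero.2 hy0)
    (by rw [norm_real, Real.norm_eq_abs, abs_neg]; exact hy)).2
  have h2 := (((hasSum_eulerIntegral γ hμ hb hy).tendsto_sum_nat).comp (tendsto_add_atTop_nat 1))
  refine tendsto_nhds_unique (h1.const_mul (Gamma b))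
    ((h2.const_mul (Gamma (-γ))).congr fun N => ?_)
  simp only [Function.comp, Finset.mul_sum]
  refine Finset.sum_congr rfl fun n _ => ?_
  have hn : (0 : ℝ) ≤ n := n.cast_nonneg
  have hμn : 0 < (μ + n).re := by simp; linarith
  have hγ' : ∀ k : ℕ, -γ ≠ -k := fun k h => hγ k (neg_injective h)
  have hg : Gamma (-γ) ≠ 0 := Gamma_ne_zero hγ'
  rw [betaIntegral_eq_Gamma_mul_div _ _ hμn hb, ← Gamma_add_nat_div_Gamma_eq (-γ) hγ',
    show μ + n + b = μ + b + n by ring, ofReal_neg, neg_pow (y : ℂ)]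
  have hs : ((-1 : ℂ) ^ n) * (-1) ^ n = 1 := by rw [← mul_pow]; simp
  have hg' : Gamma (-γ) * (Gamma (-γ + n) / Gamma (-γ)) = Gamma (-γ + n) := mul_div_cancel₀ _ hg
  linear_combination -(Gamma b / n.factorial * Gamma (-γ + n) * Gamma (μ + n) / Gamma (μ + b + n)
    * (y : ℂ) ^ n) * hs + ((y : ℂ) ^ n / n.factorial * (Gamma (μ + n) * Gamma b
    / Gamma (μ + b + n))) * hg'

/-- The substitution `t = x - (x-u)τ`. Since `1 - yτ > 0`, the power `t^γ = (x (1-yτ))^γ` splits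
also for negative `x`. -/
theorem integral_eq_eulerIntegral {γ μ b : ℂ} {u x : ℝ} (hux : u < x) (hx : x ≠ 0)
    (hy : |(x - u) / x| < 1) :
    ∫ t in u..x, (t : ℂ) ^ γ * ((t - u : ℝ) : ℂ) ^ (b - 1) * ((x - t : ℝ) : ℂ) ^ (μ - 1) =
      (x : ℂ) ^ γ * ((x - u : ℝ) : ℂ) ^ (μ + b - 1) * eulerIntegral γ μ b ((x - u) / x) := by
  set f : ℝ → ℂ := fun t =>
    (t : ℂ) ^ γ * ((t - u : ℝ) : ℂ) ^ (b - 1) * ((x - t : ℝ) : ℂ) ^ (μ - 1) with hf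
  have hd : 0 < x - u := sub_pos.2 hux
  have hd' : ((x - u : ℝ) : ℂ) ≠ 0 := by exact_mod_cast hd.ne'
  have h1 := intervalIntegral.integral_comp_sub_mul (a := 0) (b := 1) f hd.ne' x
  simp only [mul_one, mul_zero, sub_zero, sub_sub_cancel] at h1
  have h2 : ∫ t in u..x, f t = ((x - u : ℝ) : ℂ) * ∫ τ in (0 : ℝ)..1, f (x - (x - u) * τ) := by
    rw [h1, Complex.real_smul, ofReal_inv, mul_inv_cancel_left₀ hd']
  rw [h2, eulerIntegral, ← intervalIntegral.integral_const_mul,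
    ← intervalIntegral.integral_const_mul]
  refine intervalIntegral.integral_congr_ae ?_
  have hne : ∀ᵐ τ : ℝ, τ ≠ 1 := by simp [ae_iff]
  filter_upwards [hne] with τ hτ1 hτ
  rw [uIoc_of_le zero_le_one] at hτ
  have hτ' : τ < 1 := lt_of_le_of_ne hτ.2 hτ1
  have hpos : 0 < 1 - (x - u) / x * τ := by
    have h3 := (abs_lt.1 hy).2
    have h4 := (abs_lt.1 hy).1
    nlinarith [hτ.1]
  have e1 : ((x - (x - u) * τ : ℝ) : ℂ) = ((1 - (x - u) / x * τ : ℝ) : ℂ) * x := by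
    have : (x : ℂ) ≠ 0 := by exact_mod_cast hx
    push_cast
    field_simp
  have e2 : ((x - (x - u) * τ - u : ℝ) : ℂ) = ((x - u : ℝ) : ℂ) * ((1 - τ : ℝ) : ℂ) := by
    push_cast; ring
  have e3 : ((x - (x - (x - u) * τ) : ℝ) : ℂ) = ((x - u : ℝ) : ℂ) * (τ : ℂ) := by
    push_cast; ring
  simp only [hf]
  rw [e1, e2, e3, ofReal_mul_cpow hpos, ofReal_mul_cpow hd, ofReal_mul_cpow hd,
    show μ + b - 1 = 1 + (b - 1) + (μ - 1) by ring, cpow_add _ _ hd', cpow_add _ _ hd', cpow_one]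
  push_cast
  ring

/-! ### Contour integrals as integrals over a measure space -/

/-- The functional `Λ`, defined for the functions with `Conv`, is a finite sum of weighted integrals
along measurable curves `z i`, `t ∈ s i`, with traces in `tr` and bounded weights `v i`. -/
def IsCurveIntegral (Conv : (ℂ → ℂ) → Prop) (Λ : (ℂ → ℂ) → ℂ) (tr : Set ℂ) : Prop :=
  ∃ (ι : Type) (_ : Fintype ι) (s : ι → Set ℝ) (z v : ι → ℝ → ℂ),
    (∀ i, MeasurableSet (s i)) ∧ (∀ i, Measurable (z i)) ∧ (∀ i, Measurable (v i)) ∧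
    (∃ C : ℝ, ∀ i t, ‖v i t‖ ≤ C) ∧ (∀ i, ∀ t ∈ s i, z i t ∈ tr) ∧
    (∀ F, Conv F ↔ ∀ i, IntegrableOn (fun t => F (z i t)) (s i)) ∧
    ∀ F, Conv F → Λ F = ∑ i, ∫ t in s i, v i t * F (z i t)

theorem isCurveIntegral_path (p : MBPath) (hp : p.rightSide.Nonempty) :
    IsCurveIntegral p.Converges p.integral p.trace := by
  cases p with
  | line c =>
    refine ⟨Unit, inferInstance, fun _ => univ, fun _ t => c + t * I, fun _ _ => I,
      fun _ => MeasurableSet.univ, fun _ => by fun_prop, fun _ => by fun_prop,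
      ⟨1, fun _ _ => by simp⟩, fun _ t _ => ?_, fun F => ?_, fun F _ => ?_⟩
    · simp [MBPath.trace]
    · simp [MBPath.Converges, integrableOn_univ]
    · simp [MBPath.integral, integral_const_mul]
  | loop c T =>
    have hT : 0 < T := by
      obtain ⟨z, -, hz⟩ := hp
      exact (abs_nonneg _).trans_lt hz
    refine ⟨Fin 3, inferInstance, ![Icc (-T) T, Ioi c, Ioi c],
      ![fun t => c + t * I, fun t => t + T * I, fun t => t - T * I],
      ![fun _ => I, fun _ => 1, fun _ => -1], ?_, ?_, ?_, ⟨1, ?_⟩, ?_, fun F => ?_, fun F _ => ?_⟩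
    · simp [Fin.forall_fin_succ, measurableSet_Icc, measurableSet_Ioi]
    · simp only [Fin.forall_fin_succ, Matrix.cons_val_zero, Matrix.cons_val_succ,
        IsEmpty.forall_iff, and_true]
      exact ⟨by fun_prop, by fun_prop, by fun_prop⟩
    · simp only [Fin.forall_fin_succ, Matrix.cons_val_zero, Matrix.cons_val_succ,
        IsEmpty.forall_iff, and_true]
      exact ⟨by fun_prop, by fun_prop, by fun_prop⟩
    · simp [Fin.forall_fin_succ]
    · simp only [Fin.forall_fin_succ, Matrix.cons_val_zero, Matrix.cons_val_succ,
        IsEmpty.forall_iff, and_true]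
      refine ⟨fun t ht => Or.inl ?_, fun t ht => Or.inr ?_, fun t ht => Or.inr ?_⟩
      · simpa using abs_le.2 ht
      · simpa [abs_of_pos hT] using le_of_lt ht
      · simpa [abs_of_pos hT] using le_of_lt ht
    · simp [MBPath.Converges, Fin.forall_fin_succ]
    · simp only [MBPath.integral, Fin.sum_univ_three, Matrix.cons_val_zero, Matrix.cons_val_one,
        Matrix.cons_val_two, Matrix.head_cons, Matrix.tail_cons, integral_const_mul]
      rw [integral_Icc_eq_integral_Ioc, intervalIntegral.integral_of_le (by linarith)]
      simp [sub_eq_add_neg]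

theorem isCurveIntegral_contour (L : MBContour) (S : Set ℂ) (hfin : (L.indented S).Finite)
    (hr : 0 < L.r) (hp : L.path.rightSide.Nonempty) :
    IsCurveIntegral (L.Converges S) (L.mbIntegral S) (L.trace S) := by
  obtain ⟨ι, _, s, z, v, hs, hz, hv, ⟨C, hC⟩, htr, hconv, hint⟩ := isCurveIntegral_path L.path hp
  obtain ⟨k, hk⟩ : ∃ k : ℂ, k = (2 * (Real.pi : ℂ) * I)⁻¹ := ⟨_, rfl⟩
  have hder : ∀ c : ℂ, ∀ t : ℝ, deriv (circleMap c L.r) t = circleMap 0 L.r t * I := fun c t =>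
    deriv_circleMap c L.r t
  refine ⟨ι ⊕ hfin.toFinset, inferInstance, Sum.elim s fun _ => Ioc 0 (2 * Real.pi),
    Sum.elim z fun c t => circleMap c L.r t,
    Sum.elim (fun i t => k * v i t) fun c t => k * (circleMap 0 L.r t * I),
    ?_, ?_, ?_, ⟨max (‖k‖ * C) (‖k‖ * L.r), ?_⟩, ?_, fun F => ?_, fun F hF => ?_⟩
  · rintro (i | c)
    exacts [hs i, measurableSet_Ioc]
  · rintro (i | c)
    exacts [hz i, (continuous_circleMap _ _).measurable]
  · rintro (i | c)
    exacts [(hv i).const_mul k,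
      (((continuous_circleMap _ _).measurable).mul_const I).const_mul k]
  · rintro (i | c) t
    · refine le_max_of_le_left ?_
      simp only [Sum.elim_inl, norm_mul]
      gcongr
      exact hC i t
    · refine le_max_of_le_right ?_
      simp [abs_of_pos hr]
  · rintro (i | c) t ht
    · exact Or.inl (htr i t ht)
    · refine Or.inr (mem_iUnion₂.2 ⟨c, hfin.mem_toFinset.1 c.2, ?_⟩)
      exact circleMap_mem_sphere _ hr.le _
  · rw [MBContour.Converges, hconv]
    constructor
    · rintro ⟨h1, h2⟩ (i | c)
      · exact h1 i
      · exact (intervalIntegrable_iff_integrableOn_Ioc_of_le Real.two_pi_pos.le).1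
          (h2 c (hfin.mem_toFinset.1 c.2))
    · intro h
      refine ⟨fun i => h (Sum.inl i), fun c hc => ?_⟩
      exact (intervalIntegrable_iff_integrableOn_Ioc_of_le Real.two_pi_pos.le).2
        (h (Sum.inr ⟨c, hfin.mem_toFinset.2 hc⟩))
  · rw [MBContour.mbIntegral, ← hk, hint F hF.1, finsum_mem_eq_finite_toFinset_sum _ hfin,
      Fintype.sum_sum_type, mul_add, Finset.mul_sum, Finset.mul_sum]
    congr 1
    · refine Finset.sum_congr rfl fun i _ => ?_
      simp only [Sum.elim_inl, mul_assoc, integral_const_mul]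
    · rw [← Finset.sum_coe_sort]
      refine Finset.sum_congr rfl fun c _ => ?_
      simp only [Sum.elim_inr, mul_assoc, integral_const_mul]
      rw [circleIntegral, intervalIntegral.integral_of_le Real.two_pi_pos.le]
      simp only [hder, smul_eq_mul, mul_assoc]

/-- The integral along an indented contour as an integral over a measure space. -/
theorem exists_measure_contour (L : MBContour) (S : Set ℂ) (hfin : (L.indented S).Finite)
    (hr : 0 < L.r) (hp : L.path.rightSide.Nonempty) :
    ∃ (Y : Type) (_ : MeasurableSpace Y) (ν : Measure Y) (ζ ω : Y → ℂ), SFinite ν ∧ Measurable ζ ∧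
      Measurable ω ∧ (∃ C : ℝ, ∀ y, ‖ω y‖ ≤ C) ∧ (∀ᵐ y ∂ν, ζ y ∈ L.trace S) ∧
      (∀ F, L.Converges S F ↔ Integrable (fun y => F (ζ y)) ν) ∧
      ∀ F, L.Converges S F → L.mbIntegral S F = ∫ y, ω y * F (ζ y) ∂ν := by
  obtain ⟨ι, _, s, z, v, hs, hz, hv, ⟨C, hC⟩, htr, hconv, hint⟩ :=
    isCurveIntegral_contour L S hfin hr hp
  let _ : MeasurableSpace ι := ⊤
  have hemb : ∀ i : ι, MeasurableEmbedding (Prod.mk i : ℝ → ι × ℝ) := fun i =>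
    measurableEmbedding_prodMk_left i
  set ν : Measure (ι × ℝ) := ∑ i, (volume.restrict (s i)).map (Prod.mk i) with hν
  have hmeas : ∀ f : ι → ℝ → ℂ, (∀ i, Measurable (f i)) →
      Measurable (fun y : ι × ℝ => f y.1 y.2) := fun f hf =>
    measurable_from_prod_countable_right fun i => hf i
  have hI : ∀ g : ι × ℝ → ℂ, Integrable g ν ↔ ∀ i, IntegrableOn (fun t => g (i, t)) (s i) := by
    intro g
    rw [hν, integrable_finsetSum_measure]
    simp only [Finset.mem_univ, forall_true_left]
    refine forall_congr' fun i => ?_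
    exact (hemb i).integrable_map_iff
  refine ⟨ι × ℝ, inferInstance, ν, fun y => z y.1 y.2, fun y => v y.1 y.2, ?_, hmeas z hz,
    hmeas v hv, ⟨C, fun y => hC y.1 y.2⟩, ?_, fun F => ?_, fun F hF => ?_⟩
  · rw [hν, ← Measure.sum_fintype]; infer_instance
  · rw [hν, ae_finsetSum_measure_iff]
    intro i _
    rw [(hemb i).ae_map_iff]
    exact (ae_restrict_iff' (hs i)).2 (Eventually.of_forall fun t ht => htr i t ht)
  · rw [hconv F, hI]
  · rw [hint F hF, hν, integral_finsetSum_measure]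
    · refine Finset.sum_congr rfl fun i _ => ?_
      rw [(hemb i).integral_map]
    · intro i _
      rw [(hemb i).integrable_map_iff]
      have h1 := (hconv F).1 hF i
      exact h1.bdd_mul ((hv i).aestronglyMeasurable) (Eventually.of_forall (hC i))

/-! ### Estimates for the weights -/

/-- On an interval without `0` the modulus of `t^γ` is monotone, because the argument of `t` is
constant; so it is bounded by the sum of its values at the end points. -/
theorem norm_cpow_le_of_between (γ : ℂ) {u t x : ℝ} (hut : u ≤ t) (htx : t ≤ x)
    (hs : 0 < u ∨ x < 0) : ‖(t : ℂ) ^ γ‖ ≤ ‖(u : ℂ) ^ γ‖ + ‖(x : ℂ) ^ γ‖ := by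
  have hmono : ∀ p q r : ℝ, 0 < p → p ≤ q → q ≤ r → q ^ γ.re ≤ p ^ γ.re + r ^ γ.re := by
    intro p q r hp hpq hqr
    have hp' := Real.rpow_nonneg hp.le γ.re
    have hr' := Real.rpow_nonneg (hp.le.trans (hpq.trans hqr)) γ.re
    rcases le_total 0 γ.re with h | h
    · have := Real.rpow_le_rpow (hp.le.trans hpq) hqr h
      linarith
    · have := Real.rpow_le_rpow_of_nonpos hp hpq h
      linarith
  rcases hs with hu | hx
  · rw [norm_cpow_eq_rpow_re_of_pos hu, norm_cpow_eq_rpow_re_of_pos (hu.trans_le hut),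
      norm_cpow_eq_rpow_re_of_pos (hu.trans_le (hut.trans htx))]
    exact hmono u t x hu hut htx
  · have hneg : ∀ s : ℝ, s < 0 → ‖(s : ℂ) ^ γ‖ = (-s) ^ γ.re / Real.exp (Real.pi * γ.im) := by
      intro s hs
      rw [norm_cpow_of_ne_zero (by exact_mod_cast hs.ne), norm_real, Real.norm_eq_abs,
        abs_of_neg hs, arg_ofReal_of_neg hs]
    rw [hneg t (htx.trans_lt hx), hneg u ((hut.trans htx).trans_lt hx), hneg x hx, ← add_div]
    gcongr
    rw [add_comm]
    exact hmono (-x) (-t) (-u) (by linarith) (by linarith) (by linarith)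

/-- The real Beta integral. -/
def realBeta (b m : ℝ) : ℝ := ∫ τ in (0 : ℝ)..1, τ ^ (b - 1) * (1 - τ) ^ (m - 1)

theorem integral_beta_weight {b m : ℝ} (hb : 0 < b) (hm : 0 < m) {u x : ℝ} (hux : u < x) :
    IntegrableOn (fun t => (t - u) ^ (b - 1) * (x - t) ^ (m - 1)) (Ioo u x) ∧
    ∫ t in Ioo u x, (t - u) ^ (b - 1) * (x - t) ^ (m - 1) =
      (x - u) ^ (m + b - 1) * realBeta b m := by
  have hd : 0 < x - u := sub_pos.2 hux
  set F : ℝ → ℝ := fun τ => τ ^ (b - 1) * (1 - τ) ^ (m - 1) with hF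
  have hF01 : IntervalIntegrable F volume 0 1 := by
    have h := (betaIntegral_convergent (u := (b : ℂ)) (v := (m : ℂ)) (by simpa) (by simpa)).norm
    rw [intervalIntegrable_iff_integrableOn_Ioo_of_le zero_le_one] at h ⊢
    refine h.congr_fun (fun τ hτ => ?_) measurableSet_Ioo
    have h1 : (1 : ℂ) - τ = ((1 - τ : ℝ) : ℂ) := by push_cast; rfl
    simp only [hF]
    rw [norm_mul, h1, norm_cpow_eq_rpow_re_of_pos hτ.1,
      norm_cpow_eq_rpow_re_of_pos (sub_pos.2 hτ.2)]
    simp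
  have hsub : ∀ t ∈ Ioo u x, (x - u) ^ (m + b - 2) * F ((x - u)⁻¹ * t - (x - u)⁻¹ * u)
      = (t - u) ^ (b - 1) * (x - t) ^ (m - 1) := by
    intro t ht
    have h1 : (x - u)⁻¹ * t - (x - u)⁻¹ * u = (t - u) / (x - u) := by field_simp
    have h2 : 1 - (t - u) / (x - u) = (x - t) / (x - u) := by field_simp; ring
    simp only [hF]
    rw [h1, h2, Real.div_rpow (sub_pos.2 ht.1).le hd.le, Real.div_rpow (sub_pos.2 ht.2).le hd.le,
      show m + b - 2 = (b - 1) + (m - 1) by ring, Real.rpow_add hd]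
    have := (Real.rpow_pos_of_pos hd (b - 1)).ne'
    have := (Real.rpow_pos_of_pos hd (m - 1)).ne'
    field_simp
  have hc : (x - u)⁻¹ ≠ 0 := inv_ne_zero hd.ne'
  have e0 : (x - u)⁻¹ * u - (x - u)⁻¹ * u = 0 := by ring
  have e1 : (x - u)⁻¹ * x - (x - u)⁻¹ * u = 1 := by field_simp
  have hint : IntervalIntegrable (fun t => F ((x - u)⁻¹ * t - (x - u)⁻¹ * u)) volume u x := by
    have h := (hF01.comp_sub_right ((x - u)⁻¹ * u)).comp_mul_left (c := (x - u)⁻¹)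
    have h3 : (0 + (x - u)⁻¹ * u) / (x - u)⁻¹ = u := by field_simp; ring
    have h4 : (1 + (x - u)⁻¹ * u) / (x - u)⁻¹ = x := by field_simp; ring
    rwa [h3, h4] at h
  have hval := intervalIntegral.integral_comp_mul_sub (a := u) (b := x) F hc ((x - u)⁻¹ * u)
  rw [e0, e1, inv_inv, smul_eq_mul] at hval
  constructor
  · rw [intervalIntegrable_iff_integrableOn_Ioo_of_le hux.le] at hint
    exact IntegrableOn.congr_fun (hint.const_mul ((x - u) ^ (m + b - 2))) hsub measurableSet_Ioo
  · rw [← setIntegral_congr_fun measurableSet_Ioo hsub, integral_const_mul,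
      ← integral_Ioc_eq_integral_Ioo, ← intervalIntegral.integral_of_le hux.le, hval, realBeta,
      ← mul_assoc, show m + b - 1 = (m + b - 2) + 1 by ring, Real.rpow_add_one hd.ne']

theorem realBeta_nonneg (b m : ℝ) : 0 ≤ realBeta b m := by
  refine intervalIntegral.integral_nonneg zero_le_one fun τ hτ => ?_
  exact mul_nonneg (Real.rpow_nonneg hτ.1 _) (Real.rpow_nonneg (sub_nonneg.2 hτ.2) _)

/-- With the factor `|t^γ|` the Beta integral is still finite, and is bounded through the values of
`|t^γ|` at the ends of the interval. -/
theorem integral_power_weight (γ : ℂ) {b m : ℝ} (hb : 0 < b) (hm : 0 < m) {u x : ℝ} (hux : u < x)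
    (hs : 0 < u ∨ x < 0) :
    IntegrableOn (fun t : ℝ => ‖(t : ℂ) ^ γ‖ * ((t - u) ^ (b - 1) * (x - t) ^ (m - 1))) (Ioo u x) ∧
    ∫ t in Ioo u x, ‖(t : ℂ) ^ γ‖ * ((t - u) ^ (b - 1) * (x - t) ^ (m - 1)) ≤
      (‖(u : ℂ) ^ γ‖ + ‖(x : ℂ) ^ γ‖) * ((x - u) ^ (m + b - 1) * realBeta b m) := by
  obtain ⟨h1, h2⟩ := integral_beta_weight hb hm hux
  have hle : ∀ t ∈ Ioo u x, ‖‖(t : ℂ) ^ γ‖ * ((t - u) ^ (b - 1) * (x - t) ^ (m - 1))‖ ≤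
      (‖(u : ℂ) ^ γ‖ + ‖(x : ℂ) ^ γ‖) * ((t - u) ^ (b - 1) * (x - t) ^ (m - 1)) := by
    intro t ht
    have h3 : 0 ≤ (t - u) ^ (b - 1) * (x - t) ^ (m - 1) :=
      mul_nonneg (Real.rpow_nonneg (sub_pos.2 ht.1).le _) (Real.rpow_nonneg (sub_pos.2 ht.2).le _)
    rw [Real.norm_of_nonneg (mul_nonneg (norm_nonneg _) h3)]
    exact mul_le_mul_of_nonneg_right (norm_cpow_le_of_between γ ht.1.le ht.2.le hs) h3
  have h4 : IntegrableOn (fun t : ℝ => ‖(t : ℂ) ^ γ‖ * ((t - u) ^ (b - 1) * (x - t) ^ (m - 1)))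
      (Ioo u x) := by
    refine Integrable.mono' (h1.const_mul (‖(u : ℂ) ^ γ‖ + ‖(x : ℂ) ^ γ‖)) ?_
      ((ae_restrict_iff' measurableSet_Ioo).2 (Eventually.of_forall hle))
    exact Measurable.aestronglyMeasurable (by fun_prop)
  refine ⟨h4, ?_⟩
  rw [← h2, ← integral_const_mul]
  exact setIntegral_mono_on h4 (h1.const_mul _) measurableSet_Ioo fun t ht =>
    (Real.le_norm_self _).trans (hle t ht)

theorem norm_fracIntegrand (γ μ : ℂ) (φ : ℝ → ℂ) {x t : ℝ} (ht : t < x) :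
    ‖fracIntegrand γ μ φ x t‖ = ‖(t : ℂ) ^ γ‖ * ‖φ t‖ * (x - t) ^ (μ.re - 1) := by
  have hd : 0 < x - t := sub_pos.2 ht
  rw [fracIntegrand, norm_div, norm_mul, norm_cpow_eq_rpow_re_of_pos hd, div_eq_mul_inv,
    ← Real.rpow_neg hd.le]
  simp

/-- The function `φ` is integrable with the weight which bounds the inner integral in `t`: near `x`
this follows from the existence of `(I φ)(x)`, and away from `x` from the integrability of `φ`. -/
theorem integrableOn_weight {γ μ : ℂ} {b a x : ℝ} {φ : ℝ → ℂ} (hb : 0 < b) (hax : a < x)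
    (hs : 0 ≤ a ∨ x < 0) (hφ : IntegrableOn φ (Ioo a x))
    (hφI : IntegrableOn (fracIntegrand γ μ φ x) (Ioo a x)) :
    IntegrableOn (fun u : ℝ => ‖φ u‖ *
      ((‖(u : ℂ) ^ γ‖ + ‖(x : ℂ) ^ γ‖) * (x - u) ^ (μ.re + b - 1))) (Ioo a x) := by
  -- left of the midpoint `c` the power of `x - u` is bounded, right of it `|u^γ|` is bounded below
  set c : ℝ := (a + x) / 2 with hc
  have hac : a < c := by rw [hc]; linarith
  have hcx : c < x := by rw [hc]; linarith
  have hcs : 0 < c ∨ x < 0 := hs.imp (fun h => h.trans_lt hac) id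
  set p : ℝ := μ.re + b - 1 with hp
  set K₁ : ℝ := (x - c) ^ p + (x - a) ^ p with hK₁
  set K₂ : ℝ := (x - a) ^ b * (‖(c : ℂ) ^ (-γ)‖ + ‖(x : ℂ) ^ (-γ)‖) with hK₂
  have hxa : 0 < x - a := by linarith
  have hxc : 0 < x - c := by linarith
  have hK₁0 : 0 ≤ K₁ := add_nonneg (Real.rpow_nonneg hxc.le _) (Real.rpow_nonneg hxa.le _)
  have hK₂0 : 0 ≤ K₂ := mul_nonneg (Real.rpow_nonneg hxa.le _) (by positivity)
  refine Integrable.mono' (g := fun u => (x - a) ^ b * ‖fracIntegrand γ μ φ x u‖ +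
    ‖(x : ℂ) ^ γ‖ * (K₁ * ‖φ u‖ + K₂ * ‖fracIntegrand γ μ φ x u‖)) ?_ ?_ ?_
  · exact (hφI.norm.const_mul _).add
      (((hφ.norm.const_mul _).add (hφI.norm.const_mul _)).const_mul _)
  · refine hφ.1.norm.mul (Measurable.aestronglyMeasurable (by fun_prop))
  · refine (ae_restrict_iff' measurableSet_Ioo).2 (Eventually.of_forall fun u hu => ?_)
    have hd : 0 < x - u := sub_pos.2 hu.2
    have hsplit : (x - u) ^ p = (x - u) ^ b * (x - u) ^ (μ.re - 1) := by
      rw [← Real.rpow_add hd, hp]; ring_nf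
    have hbd : (x - u) ^ b ≤ (x - a) ^ b := Real.rpow_le_rpow hd.le (by linarith [hu.1]) hb.le
    have hq : 0 ≤ (x - u) ^ (μ.re - 1) := Real.rpow_nonneg hd.le _
    have hp0 : 0 ≤ (x - u) ^ p := Real.rpow_nonneg hd.le _
    rw [Real.norm_of_nonneg (by positivity)]
    have t1 : ‖φ u‖ * (‖(u : ℂ) ^ γ‖ * (x - u) ^ p) ≤ (x - a) ^ b * ‖fracIntegrand γ μ φ x u‖ := by
      rw [norm_fracIntegrand γ μ φ hu.2, hsplit]
      calc ‖φ u‖ * (‖(u : ℂ) ^ γ‖ * ((x - u) ^ b * (x - u) ^ (μ.re - 1)))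
          = (x - u) ^ b * (‖(u : ℂ) ^ γ‖ * ‖φ u‖ * (x - u) ^ (μ.re - 1)) := by ring
        _ ≤ _ := by gcongr
    have t2 : ‖φ u‖ * (x - u) ^ p ≤ K₁ * ‖φ u‖ + K₂ * ‖fracIntegrand γ μ φ x u‖ := by
      rcases le_total u c with huc | huc
      · have h1 : (x - u) ^ p ≤ K₁ := by
          rcases le_total 0 p with h | h
          · have := Real.rpow_le_rpow hd.le (show x - u ≤ x - a by linarith [hu.1]) h
            have := Real.rpow_nonneg hxc.le p
            linarith
          · have := Real.rpow_le_rpow_of_nonpos hxc (show x - c ≤ x - u by linarith) h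
            have := Real.rpow_nonneg hxa.le p
            linarith
        calc ‖φ u‖ * (x - u) ^ p ≤ ‖φ u‖ * K₁ := by gcongr
          _ = K₁ * ‖φ u‖ := mul_comm _ _
          _ ≤ _ := le_add_of_nonneg_right (by positivity)
      · have hu0 : (u : ℂ) ≠ 0 := by
          rcases hcs with h | h
          · exact_mod_cast (h.trans_le huc).ne'
          · exact_mod_cast (hu.2.trans h).ne
        have h1 : 1 ≤ ‖(u : ℂ) ^ γ‖ * (‖(c : ℂ) ^ (-γ)‖ + ‖(x : ℂ) ^ (-γ)‖) := by
          have h2 := norm_cpow_le_of_between (-γ) huc hu.2.le hcs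
          calc (1 : ℝ) = ‖(u : ℂ) ^ γ‖ * ‖(u : ℂ) ^ (-γ)‖ := by
                rw [← norm_mul, ← cpow_add _ _ hu0, add_neg_cancel, cpow_zero, norm_one]
            _ ≤ _ := by gcongr
        have h3 : ‖φ u‖ * (x - u) ^ p ≤ K₂ * ‖fracIntegrand γ μ φ x u‖ := by
          rw [norm_fracIntegrand γ μ φ hu.2, hsplit, hK₂]
          calc ‖φ u‖ * ((x - u) ^ b * (x - u) ^ (μ.re - 1))
              ≤ ‖φ u‖ * ((x - a) ^ b * (x - u) ^ (μ.re - 1)) * 1 := by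
                rw [mul_one]; gcongr
            _ ≤ ‖φ u‖ * ((x - a) ^ b * (x - u) ^ (μ.re - 1)) *
                (‖(u : ℂ) ^ γ‖ * (‖(c : ℂ) ^ (-γ)‖ + ‖(x : ℂ) ^ (-γ)‖)) := by gcongr
            _ = _ := by ring
        exact h3.trans (le_add_of_nonneg_left (by positivity))
    calc _ = ‖φ u‖ * (‖(u : ℂ) ^ γ‖ * (x - u) ^ p) +
          ‖(x : ℂ) ^ γ‖ * (‖φ u‖ * (x - u) ^ p) := by ring
      _ ≤ _ := by gcongr

/-! ### Interchange of the integrations -/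

section kernel

variable {Y : Type} [MeasurableSpace Y]

/-- The superposition `∫ G(y) s^{e(y)-1} dν(y)` of powers of `s`. -/
def powerKernel (ν : Measure Y) (G e : Y → ℂ) (s : ℝ) : ℂ :=
  ∫ y, G y * (s : ℂ) ^ (e y - 1) ∂ν

variable {ν : Measure Y} {G e : Y → ℂ} {b D : ℝ}

theorem norm_cpow_sub_one_le {s : ℝ} {z : ℂ} (hs : 0 < s) (hsD : s ≤ D) (hz : b ≤ z.re) :
    ‖(s : ℂ) ^ (z - 1)‖ ≤ ‖(D : ℂ) ^ (z - 1)‖ * (D ^ (b - 1))⁻¹ * s ^ (b - 1) := by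
  have hD : 0 < D := hs.trans_le hsD
  have h1 : (s / D) ^ (z.re - 1) ≤ (s / D) ^ (b - 1) :=
    Real.rpow_le_rpow_of_exponent_ge (div_pos hs hD) ((div_le_one hD).2 hsD) (by linarith)
  rw [Real.div_rpow hs.le hD.le, Real.div_rpow hs.le hD.le] at h1
  have h2 := Real.rpow_pos_of_pos hD (z.re - 1)
  rw [norm_cpow_eq_rpow_re_of_pos hs, norm_cpow_eq_rpow_re_of_pos hD]
  simp only [sub_re, one_re]
  rw [div_le_iff₀ h2] at h1
  calc s ^ (z.re - 1) ≤ _ := h1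
    _ = _ := by ring

theorem measurable_power (hGm : Measurable G) (hem : Measurable e) :
    Measurable (fun p : ℝ × Y => G p.2 * (p.1 : ℂ) ^ (e p.2 - 1)) := by
  fun_prop

theorem measurable_powerKernel [SFinite ν] (hGm : Measurable G) (hem : Measurable e) :
    Measurable (powerKernel ν G e) :=
  (StronglyMeasurable.integral_prod_right (f := fun (s : ℝ) (y : Y) => G y * (s : ℂ) ^ (e y - 1))
    (measurable_power hGm hem).stronglyMeasurable).measurable

theorem ae_norm_power_le (he : ∀ᵐ y ∂ν, b ≤ (e y).re) {s : ℝ} (hs : 0 < s) (hsD : s ≤ D) :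
    ∀ᵐ y ∂ν, ‖G y * (s : ℂ) ^ (e y - 1)‖ ≤
      ‖G y * (D : ℂ) ^ (e y - 1)‖ * ((D ^ (b - 1))⁻¹ * s ^ (b - 1)) := by
  filter_upwards [he] with y hy
  rw [norm_mul, norm_mul]
  calc ‖G y‖ * ‖(s : ℂ) ^ (e y - 1)‖
      ≤ ‖G y‖ * (‖(D : ℂ) ^ (e y - 1)‖ * (D ^ (b - 1))⁻¹ * s ^ (b - 1)) := by
        gcongr
        exact norm_cpow_sub_one_le hs hsD hy
    _ = _ := by ring

/-- Integrability at the right end `D` alone gives the bound `O(s^{b-1})` for all `0 < s ≤ D`: the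
ratio of `|s^{e-1}|` and `|D^{e-1}|` is at most `(s/D)^{b-1}`, whatever `re e ≥ b` is. -/
theorem exists_norm_powerKernel_le (he : ∀ᵐ y ∂ν, b ≤ (e y).re) (hD : 0 < D)
    (hG : Integrable (fun y => G y * (D : ℂ) ^ (e y - 1)) ν) :
    ∃ M : ℝ, 0 ≤ M ∧ ∀ s : ℝ, 0 < s → s ≤ D → ‖powerKernel ν G e s‖ ≤ M * s ^ (b - 1) := by
  refine ⟨(∫ y, ‖G y * (D : ℂ) ^ (e y - 1)‖ ∂ν) * (D ^ (b - 1))⁻¹,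
    mul_nonneg (integral_nonneg fun y => norm_nonneg _)
      (inv_nonneg.2 (Real.rpow_nonneg hD.le _)), fun s hs hsD => ?_⟩
  rw [powerKernel, mul_assoc, ← integral_mul_const]
  exact norm_integral_le_of_norm_le (hG.norm.mul_const _) (ae_norm_power_le he hs hsD)

/-- Integrating the kernel against `t^γ (x-t)^{μ-1}`: the integrations with respect to `t` and along
the contour may be interchanged, and the `t`-integral is Euler's. -/
theorem integral_powerKernel [SFinite ν] (hGm : Measurable G) (hem : Measurable e) {γ μ : ℂ}
    (hμ : 0 < μ.re) (hb : 0 < b) (he : ∀ᵐ y ∂ν, b ≤ (e y).re)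
    (hG : Integrable (fun y => G y * (D : ℂ) ^ (e y - 1)) ν) {u x : ℝ} (hux : u < x)
    (hxD : x - u ≤ D) (hs : 0 < u ∨ x < 0) (hx : x ≠ 0) (hy : |(x - u) / x| < 1) :
    Integrable (fun y => G y * ((x : ℂ) ^ γ * ((x - u : ℝ) : ℂ) ^ (μ + e y - 1) *
      eulerIntegral γ μ (e y) ((x - u) / x))) ν ∧
    ∫ t in Ioo u x, (t : ℂ) ^ γ * ((x - t : ℝ) : ℂ) ^ (μ - 1) * powerKernel ν G e (t - u) =
      ∫ y, G y * ((x : ℂ) ^ γ * ((x - u : ℝ) : ℂ) ^ (μ + e y - 1) *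
        eulerIntegral γ μ (e y) ((x - u) / x)) ∂ν := by
  set f : ℝ → Y → ℂ := fun t y =>
    (t : ℂ) ^ γ * ((x - t : ℝ) : ℂ) ^ (μ - 1) * (G y * ((t - u : ℝ) : ℂ) ^ (e y - 1)) with hf
  have hfm : Measurable (Function.uncurry f) := by
    have h1 : Measurable (fun p : ℝ × Y => G p.2 * ((p.1 - u : ℝ) : ℂ) ^ (e p.2 - 1)) :=
      (measurable_power hGm hem).comp (by fun_prop : Measurable fun p : ℝ × Y => (p.1 - u, p.2))
    have h2 : Measurable (fun p : ℝ × Y => (p.1 : ℂ) ^ γ * ((x - p.1 : ℝ) : ℂ) ^ (μ - 1)) := by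
      fun_prop
    exact h2.mul h1
  have hint : Integrable (Function.uncurry f) ((volume.restrict (Ioo u x)).prod ν) := by
    have hmaj := ((integral_power_weight γ hb hμ hux hs).1).mul_prod
      (hG.norm.mul_const (D ^ (b - 1))⁻¹)
    refine Integrable.mono' hmaj hfm.aestronglyMeasurable ?_
    have h1 : ∀ᵐ p ∂((volume.restrict (Ioo u x)).prod ν), p.1 ∈ Ioo u x :=
      Measure.quasiMeasurePreserving_fst.ae (ae_restrict_mem measurableSet_Ioo)
    have h2 : ∀ᵐ p ∂((volume.restrict (Ioo u x)).prod ν), b ≤ (e p.2).re :=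
      Measure.quasiMeasurePreserving_snd.ae he
    filter_upwards [h1, h2] with p hp1 hp2
    have h3 := norm_cpow_sub_one_le (sub_pos.2 hp1.1)
      (show p.1 - u ≤ D by linarith [hp1.2]) hp2
    simp only [Function.uncurry, hf]
    rw [norm_mul, norm_mul, norm_mul, norm_mul,
      norm_cpow_eq_rpow_re_of_pos (sub_pos.2 hp1.2), sub_re, one_re]
    have h4 : 0 ≤ (x - p.1) ^ (μ.re - 1) := Real.rpow_nonneg (sub_pos.2 hp1.2).le _
    calc _ ≤ ‖(p.1 : ℂ) ^ γ‖ * (x - p.1) ^ (μ.re - 1) * (‖G p.2‖ *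
          (‖(D : ℂ) ^ (e p.2 - 1)‖ * (D ^ (b - 1))⁻¹ * (p.1 - u) ^ (b - 1))) := by gcongr
      _ = _ := by ring
  have hEuler : ∀ᵐ y ∂ν, ∫ t in Ioo u x, f t y = G y * ((x : ℂ) ^ γ *
      ((x - u : ℝ) : ℂ) ^ (μ + e y - 1) * eulerIntegral γ μ (e y) ((x - u) / x)) := by
    filter_upwards [he] with y hy'
    rw [← integral_eq_eulerIntegral hux hx hy, intervalIntegral.integral_of_le hux.le,
      integral_Ioc_eq_integral_Ioo, ← integral_const_mul]
    refine integral_congr_ae (Eventually.of_forall fun t => ?_)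
    simp only [hf]
    ring
  refine ⟨hint.integral_prod_right.congr hEuler, ?_⟩
  rw [← integral_congr_ae hEuler, ← integral_integral_swap hint]
  refine integral_congr_ae (Eventually.of_forall fun t => ?_)
  simp only [hf, powerKernel, integral_const_mul]

end kernel

/-- Fubini's theorem for the convolution with a kernel which is `O(s^{b-1})`, followed by the
integration against `t^γ (x-t)^{μ-1}`. -/
theorem fubini_convolution {γ μ : ℂ} {b M a x : ℝ} {φ : ℝ → ℂ} {k : ℝ → ℂ} (hμ : 0 < μ.re)
    (hb : 0 < b) (hM : 0 ≤ M) (hax : a < x) (hs : 0 ≤ a ∨ x < 0) (hk : Measurable k)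
    (hkM : ∀ s, 0 < s → s ≤ x - a → ‖k s‖ ≤ M * s ^ (b - 1)) (hφ : IntegrableOn φ (Ioo a x))
    (hφI : IntegrableOn (fracIntegrand γ μ φ x) (Ioo a x)) :
    (∀ᵐ t ∂(volume.restrict (Ioo a x)), IntegrableOn (fun u => k (t - u) * φ u) (Ioo a t)) ∧
    IntegrableOn (fun t : ℝ => (t : ℂ) ^ γ * ((x - t : ℝ) : ℂ) ^ (μ - 1) *
      ∫ u in Ioo a t, k (t - u) * φ u) (Ioo a x) ∧
    IntegrableOn (fun u : ℝ => φ u *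
      ∫ t in Ioo u x, (t : ℂ) ^ γ * ((x - t : ℝ) : ℂ) ^ (μ - 1) * k (t - u)) (Ioo a x) ∧
    ∫ t in Ioo a x, (t : ℂ) ^ γ * ((x - t : ℝ) : ℂ) ^ (μ - 1) *
        ∫ u in Ioo a t, k (t - u) * φ u =
      ∫ u in Ioo a x, φ u *
        ∫ t in Ioo u x, (t : ℂ) ^ γ * ((x - t : ℝ) : ℂ) ^ (μ - 1) * k (t - u) := by
  set ρ : Measure ℝ := volume.restrict (Ioo a x) with hρ
  set W : ℝ → ℂ := fun t => (t : ℂ) ^ γ * ((x - t : ℝ) : ℂ) ^ (μ - 1) with hW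
  have hWm : Measurable W := by fun_prop
  set Φ : ℝ → ℝ → ℂ := fun u t => if u < t then φ u * (W t * k (t - u)) else 0 with hΦ
  have hΦu : ∀ u, Φ u = (Ioi u).indicator fun t => φ u * (W t * k (t - u)) := by
    intro u
    funext t
    simp [hΦ, indicator_apply]
  have hΦt : ∀ t, (fun u => Φ u t) = (Iio t).indicator fun u => W t * (k (t - u) * φ u) := by
    intro t
    funext u
    by_cases h : u < t
    · simp [hΦ, h]; ring
    · simp [hΦ, h]
  have hres : ∀ u ∈ Ioo a x, ρ.restrict (Ioi u) = volume.restrict (Ioo u x) := by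
    intro u hu
    rw [hρ, Measure.restrict_restrict measurableSet_Ioi]
    congr 1
    ext t
    exact ⟨fun h => ⟨h.1, h.2.2⟩, fun h => ⟨h.1, hu.1.trans h.1, h.2⟩⟩
  have hres' : ∀ t ∈ Ioo a x, ρ.restrict (Iio t) = volume.restrict (Ioo a t) := by
    intro t ht
    rw [hρ, Measure.restrict_restrict measurableSet_Iio]
    congr 1
    ext u
    exact ⟨fun h => ⟨h.2.1, h.1⟩, fun h => ⟨h.2, h.1, h.2.trans ht.2⟩⟩
  have hmem : ∀ᵐ u ∂ρ, u ∈ Ioo a x := ae_restrict_mem measurableSet_Ioo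
  have hsgn : ∀ u ∈ Ioo a x, 0 < u ∨ x < 0 := fun u hu => hs.imp (fun h => h.trans_lt hu.1) id
  have hmeas : AEStronglyMeasurable (Function.uncurry Φ) (ρ.prod ρ) := by
    have h1 : AEStronglyMeasurable (fun p : ℝ × ℝ => φ p.1 * (W p.2 * k (p.2 - p.1)))
        (ρ.prod ρ) := by
      refine hφ.1.comp_fst.mul (Measurable.aestronglyMeasurable ?_)
      exact (hWm.comp measurable_snd).mul (hk.comp (by fun_prop))
    have h2 : MeasurableSet {p : ℝ × ℝ | p.1 < p.2} :=
      measurableSet_lt measurable_fst measurable_snd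
    refine (h1.indicator h2).congr (Eventually.of_forall fun p => ?_)
    simp [indicator_apply, hΦ, Function.uncurry]
  -- the bound for the integrand on `u < t < x`
  have hbd : ∀ u ∈ Ioo a x, ∀ t ∈ Ioo u x, ‖φ u * (W t * k (t - u))‖ ≤
      ‖φ u‖ * M * (‖(t : ℂ) ^ γ‖ * ((t - u) ^ (b - 1) * (x - t) ^ (μ.re - 1))) := by
    intro u hu t ht
    have h1 := hkM (t - u) (sub_pos.2 ht.1) (by linarith [hu.1, ht.2])
    have h2 : 0 ≤ (x - t) ^ (μ.re - 1) := Real.rpow_nonneg (sub_pos.2 ht.2).le _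
    simp only [hW]
    rw [norm_mul, norm_mul, norm_mul, norm_cpow_eq_rpow_re_of_pos (sub_pos.2 ht.2), sub_re, one_re]
    calc _ ≤ ‖φ u‖ * (‖(t : ℂ) ^ γ‖ * (x - t) ^ (μ.re - 1) * (M * (t - u) ^ (b - 1))) := by gcongr
      _ = _ := by ring
  have hin : ∀ u ∈ Ioo a x, Integrable (Φ u) ρ := by
    intro u hu
    rw [hΦu, integrable_indicator_iff measurableSet_Ioi, IntegrableOn, hres u hu]
    refine Integrable.mono' (((integral_power_weight γ hb hμ hu.2 (hsgn u hu)).1).const_mul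
      (‖φ u‖ * M)) ?_ ((ae_restrict_iff' measurableSet_Ioo).2 (Eventually.of_forall (hbd u hu)))
    exact ((hWm.mul (hk.comp (by fun_prop))).const_mul _).aestronglyMeasurable
  have hnorm : ∀ u ∈ Ioo a x, ∫ t, ‖Φ u t‖ ∂ρ ≤ M * realBeta b μ.re * (‖φ u‖ *
      ((‖(u : ℂ) ^ γ‖ + ‖(x : ℂ) ^ γ‖) * (x - u) ^ (μ.re + b - 1))) := by
    intro u hu
    obtain ⟨h1, h2⟩ := integral_power_weight γ hb hμ hu.2 (hsgn u hu)
    have h3 := (hin u hu).norm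
    rw [hΦu] at h3 ⊢
    simp only [norm_indicator_eq_indicator_norm] at h3 ⊢
    rw [integrable_indicator_iff measurableSet_Ioi, IntegrableOn, hres u hu] at h3
    rw [integral_indicator measurableSet_Ioi, hres u hu]
    calc _ ≤ ∫ t in Ioo u x, ‖φ u‖ * M *
          (‖(t : ℂ) ^ γ‖ * ((t - u) ^ (b - 1) * (x - t) ^ (μ.re - 1))) :=
        setIntegral_mono_on h3 (h1.const_mul _) measurableSet_Ioo (hbd u hu)
      _ ≤ ‖φ u‖ * M * ((‖(u : ℂ) ^ γ‖ + ‖(x : ℂ) ^ γ‖) *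
          ((x - u) ^ (μ.re + b - 1) * realBeta b μ.re)) := by
        rw [integral_const_mul]
        gcongr
      _ = _ := by ring
  have hint : Integrable (Function.uncurry Φ) (ρ.prod ρ) := by
    rw [integrable_prod_iff hmeas]
    refine ⟨hmem.mono fun u hu => hin u hu, ?_⟩
    refine Integrable.mono' ((integrableOn_weight hb hax hs hφ hφI).const_mul
      (M * realBeta b μ.re)) hmeas.norm.integral_prod_right' ?_
    filter_upwards [hmem] with u hu
    rw [Real.norm_of_nonneg (integral_nonneg fun t => norm_nonneg _)]
    exact hnorm u hu
  have e1 : ∀ t ∈ Ioo a x, ∫ u, Φ u t ∂ρ = W t * ∫ u in Ioo a t, k (t - u) * φ u := by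
    intro t ht
    rw [hΦt, integral_indicator measurableSet_Iio, hres' t ht, integral_const_mul]
  have e2 : ∀ u ∈ Ioo a x, ∫ t, Φ u t ∂ρ = φ u * ∫ t in Ioo u x, W t * k (t - u) := by
    intro u hu
    rw [hΦu, integral_indicator measurableSet_Ioi, hres u hu, integral_const_mul]
  refine ⟨?_, ?_, ?_, ?_⟩
  · filter_upwards [hint.prod_left_ae, hmem] with t ht htm
    have h0 : W t ≠ 0 := by
      have ht0 : (t : ℂ) ≠ 0 := by
        rcases hsgn t htm with h | h
        · exact_mod_cast h.ne'
        · exact_mod_cast (htm.2.trans h).ne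
      have ht1 : ((x - t : ℝ) : ℂ) ≠ 0 := by exact_mod_cast (sub_pos.2 htm.2).ne'
      exact mul_ne_zero (by simp [cpow_eq_zero_iff, ht0]) (by rw [Ne, cpow_eq_zero_iff]; tauto)
    have h1 : Integrable (fun u => Φ u t) ρ := ht
    rw [hΦt, integrable_indicator_iff measurableSet_Iio, IntegrableOn, hres' t htm] at h1
    exact (integrable_const_mul_iff (isUnit_iff_ne_zero.2 h0) _).1 h1
  · exact hint.integral_prod_right.congr (hmem.mono fun t ht => e1 t ht)
  · exact hint.integral_prod_left.congr (hmem.mono fun u hu => e2 u hu)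
  · rw [← integral_congr_ae (hmem.mono fun t ht => e1 t ht),
      ← integral_congr_ae (hmem.mono fun u hu => e2 u hu), integral_integral_swap hint]

/-! ### The contour in the first variable -/

/-- The reciprocal of `Γ` is entire, so `Γ` is measurable, with its value `0` at the poles. -/
theorem measurable_Gamma : Measurable Complex.Gamma := by
  have h : Measurable fun s : ℂ => ((Complex.Gamma s)⁻¹)⁻¹ :=
    differentiable_one_div_Gamma.continuous.measurable.inv
  simpa using h

theorem measurable_theta {p q : ℕ} (P : HParam p q) : Measurable P.theta := by
  refine Measurable.mul (Finset.measurable_prod _ fun j _ => ?_)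
    (Finset.measurable_prod _ fun i _ => ?_)
  · split_ifs
    · exact measurable_Gamma.comp (by fun_prop)
    · exact (measurable_Gamma.comp (by fun_prop)).inv
  · split_ifs
    · exact measurable_Gamma.comp (by fun_prop)
    · exact (measurable_Gamma.comp (by fun_prop)).inv

/-- The additional pair `(1 - β, α)` contributes the factor `Γ(β + αξ)`. -/
theorem theta_consUpper {p q : ℕ} (P : HParam p q) (β : ℂ) (α : ℝ) (s : ℂ) :
    (P.consUpper (1 - β) α).theta s = Gamma (β + α * s) * P.theta s := by
  have e : (1 : ℂ) - (1 - β) + α * s = β + α * s := by ring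
  simp only [HParam.theta, HParam.consUpper, Fin.prod_univ_succ, Fin.cons_zero, Fin.cons_succ,
    Fin.val_succ, add_lt_add_iff_right, Fin.val_zero, Nat.succ_pos', if_true, e]
  exact mul_left_comm _ _ _

/-- The positive factor `s^α` may be split off from a principal power, whatever the argument of
`w` is. -/
theorem mul_rpow_cpow {s : ℝ} (hs : 0 < s) (w ξ : ℂ) (α : ℝ) :
    (w * ((s ^ α : ℝ) : ℂ)) ^ ξ = w ^ ξ * (s : ℂ) ^ (α * ξ) := by
  have h := Real.rpow_pos_of_pos hs α
  rw [mul_comm w, ofReal_mul_cpow h, mul_comm,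
    cpow_def_of_ne_zero (by exact_mod_cast h.ne' : ((s ^ α : ℝ) : ℂ) ≠ 0),
    cpow_def_of_ne_zero (by exact_mod_cast hs.ne' : (s : ℂ) ≠ 0), ← ofReal_log h.le,
    ← ofReal_log hs.le, Real.log_rpow hs]
  push_cast
  ring_nf

theorem mbIntegral_congr_indented {L : MBContour} {S S' : Set ℂ} (h : L.indented S = L.indented S')
    (F : ℂ → ℂ) : L.mbIntegral S F = L.mbIntegral S' F := by
  rw [MBContour.mbIntegral, MBContour.mbIntegral, h]

theorem converges_congr_indented {L : MBContour} {S S' : Set ℂ} (h : L.indented S = L.indented S')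
    (F : ℂ → ℂ) : L.Converges S F ↔ L.Converges S' F := by
  rw [MBContour.Converges, MBContour.Converges, h]

/-- The contour stays away from the line `re (β + αξ) = 0`, to the right of it. Hence no pole of
`Γ(β + αξ)` has to be avoided by indentation, and the same circles belong to the contour of the
`H`-function and to that of the kernel. -/
theorem exists_half_plane {p q : ℕ} {P : HParam p q} {β : ℂ} {α : ℝ} {L : MBContour} (hα : 0 < α)
    (hL : L.Separates (P.consUpper (1 - β) α))
    (hLβ : ∀ ξ ∈ L.path.trace, 0 < (β + (α : ℂ) * ξ).re) :
    (∃ b : ℝ, 0 < b ∧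
      ∀ ξ ∈ L.trace (P.consUpper (1 - β) α).leftPoles, b ≤ (β + (α : ℂ) * ξ).re) ∧
    L.indented (P.consUpper (1 - β) α).leftPoles = L.indented P.leftPoles := by
  obtain ⟨-, hne, -, -, hcirc⟩ := hL
  obtain ⟨c, hc1, hc2, hc3⟩ := exists_re_bound L.path
  have hre : ∀ ξ : ℂ, (β + (α : ℂ) * ξ).re = β.re + α * ξ.re := fun ξ => by simp
  have hb : 0 < β.re + α * c := by
    have := hLβ c (hc1 hne)
    rwa [hre, ofReal_re] at this
  have hle : ∀ ξ : ℂ, c ≤ ξ.re → β.re + α * c ≤ (β + (α : ℂ) * ξ).re := fun ξ hξ => by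
    rw [hre]; gcongr
  refine ⟨⟨β.re + α * c, hb, fun ξ hξ => hle ξ ?_⟩, ?_⟩
  · rcases hξ with h | h
    · exact hc2 ξ h
    · obtain ⟨s, hs, hξs⟩ := mem_iUnion₂.1 h
      exact (hc3 ξ ((hcirc s hs).1 (Metric.sphere_subset_closedBall hξs))).le
  · ext s
    constructor
    · rintro ⟨⟨i, hi, k, hk⟩, hs⟩
      refine ⟨?_, hs⟩
      revert hi hk
      refine Fin.cases ?_ (fun j => ?_) i
      · intro _ hk
        exfalso
        simp only [HParam.consUpper, Fin.cons_zero] at hk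
        have h1 := hle s (hc3 s hs).le
        have h2 : β + (α : ℂ) * s = -(k : ℂ) := by rw [← hk]; ring
        have hk0 : (0 : ℝ) ≤ k := k.cast_nonneg
        rw [h2, neg_re, natCast_re] at h1
        linarith
      · intro hi hk
        simp only [HParam.consUpper, Fin.cons_succ, Fin.val_succ, add_lt_add_iff_right] at hi hk
        exact ⟨j, hi, k, hk⟩
    · rintro ⟨⟨j, hj, k, hk⟩, hs⟩
      exact ⟨⟨j.succ, by simpa [HParam.consUpper] using hj, k,
        by simpa only [HParam.consUpper, Fin.cons_succ] using hk⟩, hs⟩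

/-- The condition `|(x-u)/x| < 1` means that `0 ≤ a` or `x < 0`: the interval does not contain the
branch point of `t^γ`. -/
theorem nonneg_or_neg_of_abs_lt {a x : ℝ} (hx : x ≠ 0)
    (hu : ∀ u ∈ Ioo a x, |(x - u) / x| < 1) : 0 ≤ a ∨ x < 0 := by
  by_contra! h
  obtain ⟨ha, hx0⟩ := h
  have hx' : 0 < x := lt_of_le_of_ne hx0 hx.symm
  -- if `a < 0 < x`, then `u = a / 2` violates the assumption
  have h1 := (abs_lt.1 (hu (a / 2) ⟨by linarith, by linarith⟩)).2
  rw [div_lt_one hx'] at h1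
  linarith

end MellinBarnes

end

open MellinBarnes

theorem theorem2 {p q : ℕ} (P : HParam p q) (γ μ β w : ℂ) (α a x : ℝ) (φ : ℝ → ℂ)
    (L₁ L₂ : MBContour)
    -- the parameters
    (hγ : -1 < γ.re) (hμ : 0 < μ.re) (hβ : 0 < β.re) (hw : w ≠ 0) (hα : 0 < α)
    (hm : 1 ≤ P.m) (hmq : P.m ≤ q) (hnp : P.n ≤ p)
    (hA : ∀ i, 0 < P.A i) (hB : ∀ j, 0 < P.B j)
    (hmin : ∀ j : Fin q, (j : ℕ) < P.m → 0 < β.re + ((α : ℂ) * P.b j / (P.B j : ℂ)).re)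
    (hγ' : ∀ k : ℕ, γ ≠ (k : ℂ))
    -- the interval
    (hax : a < x) (hx : x ≠ 0) (hu : ∀ u ∈ Ioo a x, |(x - u) / x| < 1)
    -- the contour in the first variable
    (hL₁ : L₁.Separates (P.consUpper (1 - β) α))
    (hL₁β : ∀ ξ ∈ L₁.path.trace, 0 < (β + (α : ℂ) * ξ).re)
    (hconv : ∀ s ∈ Ioc 0 (x - a),
      L₁.Converges P.leftPoles (foxIntegrand P (w * ((s ^ α : ℝ) : ℂ))))
    -- the contour in the second variable
    (hL₂ : L₂.Separates (kernelSecond γ μ))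
    (hL₂loop : ∃ c T : ℝ, L₂.path = MBPath.loop c T)
    -- the function
    (hφ : IntegrableOn φ (Ioo a x))
    (hφI : IntegrableOn (fracIntegrand γ μ φ x) (Ioo a x)) :
    -- the integrals on the left exist
    (∀ᵐ t ∂(volume.restrict (Ioo a x)),
      IntegrableOn (hOpIntegrand P L₁ w α β φ t) (Ioo a t)) ∧
    IntegrableOn (fracIntegrand γ μ (hOp P L₁ w α β a φ) x) (Ioo a x) ∧
    -- the integrals on the right exist
    (∀ u ∈ Ioo a x, FoxH₂Converges (kernelJoint μ β α) (P.consUpper (1 - β) α)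
      (kernelSecond γ μ) L₁ L₂ (w * (((x - u) ^ α : ℝ) : ℂ)) ((-((x - u) / x) : ℝ) : ℂ)) ∧
    IntegrableOn (fun u : ℝ => ((x - u : ℝ) : ℂ) ^ (μ + β - 1) *
      foxH₂ (kernelJoint μ β α) (P.consUpper (1 - β) α) (kernelSecond γ μ) L₁ L₂
        (w * (((x - u) ^ α : ℝ) : ℂ)) ((-((x - u) / x) : ℝ) : ℂ) * φ u) (Ioo a x) ∧
    -- the composition formula
    fracI γ μ a (hOp P L₁ w α β a φ) x =
      (x : ℂ) ^ γ * ((x - a : ℝ) : ℂ) ^ (-μ - γ) / (Complex.Gamma μ * Complex.Gamma (-γ)) *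
        ∫ u in a..x, ((x - u : ℝ) : ℂ) ^ (μ + β - 1) *
          foxH₂ (kernelJoint μ β α) (P.consUpper (1 - β) α) (kernelSecond γ μ) L₁ L₂
            (w * (((x - u) ^ α : ℝ) : ℂ)) ((-((x - u) / x) : ℝ) : ℂ) * φ u ∧
    -- the Euler integral behind the kernel
    (∀ u ∈ Ioo a x, ∀ ξ : ℂ, 0 < (β + (α : ℂ) * ξ).re →
      ∫ t in u..x, (t : ℂ) ^ γ * ((t - u : ℝ) : ℂ) ^ (β + (α : ℂ) * ξ - 1) *
          ((x - t : ℝ) : ℂ) ^ (μ - 1) =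
        (x : ℂ) ^ γ * ((x - u : ℝ) : ℂ) ^ (μ + β + (α : ℂ) * ξ - 1) *
          Complex.betaIntegral μ (β + (α : ℂ) * ξ) *
          ordinaryHypergeometric (-γ) μ (μ + β + (α : ℂ) * ξ) (((x - u) / x : ℝ) : ℂ)) := by
  have hpole := exists_half_plane hα hL₁ hL₁β
  obtain ⟨⟨b, hb, htr⟩, hind⟩ := hpole
  have hA' : ∀ i, 0 < (P.consUpper (1 - β) α).A i := Fin.cases hα hA
  obtain ⟨Y, _, ν, ζ, ω, _, hζ, hω, ⟨C, hC⟩, hζtr, hcv, hmb⟩ := exists_measure_contour L₁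
    (P.consUpper (1 - β) α).leftPoles (indented_finite _ hA' L₁) hL₁.1 hL₁.2.1
  have hs := nonneg_or_neg_of_abs_lt hx hu
  have hD : 0 < x - a := sub_pos.2 hax
  -- the density without (`G₀`) and with (`G`) the weight of the contour: absolute convergence is a
  -- statement about `G₀`, while the values of the integrals involve `G`
  set e : Y → ℂ := fun y => β + α * ζ y with he
  set G₀ : Y → ℂ := fun y => P.theta (ζ y) * w ^ ζ y with hG₀
  set G : Y → ℂ := fun y => ω y * G₀ y with hG
  have hem : Measurable e := by fun_prop
  have hG₀m : Measurable G₀ := ((measurable_theta P).comp hζ).mul (hζ.const_pow w)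
  have hGm : Measurable G := hω.mul hG₀m
  have heb : ∀ᵐ y ∂ν, b ≤ (e y).re := hζtr.mono fun y hy => htr _ hy
  -- the hypothesis on the convergence of the `H`-function at the right end of the interval
  have hpow : ∀ s : ℝ, 0 < s → ∀ y, G₀ y * (s : ℂ) ^ (e y - 1) =
      (s : ℂ) ^ (β - 1) * foxIntegrand P (w * ((s ^ α : ℝ) : ℂ)) (ζ y) := by
    intro s hs y
    have hs' : (s : ℂ) ≠ 0 := by exact_mod_cast hs.ne'
    rw [foxIntegrand, mul_rpow_cpow hs, he, hG₀]
    simp only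
    rw [show β + α * ζ y - 1 = (β - 1) + α * ζ y by ring, Complex.cpow_add _ _ hs']
    ring
  have hG₀i : Integrable (fun y => G₀ y * ((x - a : ℝ) : ℂ) ^ (e y - 1)) ν := by
    simp only [hpow _ hD]
    exact ((hcv _).1 ((converges_congr_indented hind _).2 (hconv _ ⟨hD, le_rfl⟩))).const_mul _
  have hGi : Integrable (fun y => G y * ((x - a : ℝ) : ℂ) ^ (e y - 1)) ν := by
    simp only [hG, mul_assoc (ω _)]
    exact hG₀i.bdd_mul hω.aestronglyMeasurable (Filter.Eventually.of_forall hC)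
  have hker : ∀ s : ℝ, 0 < s → s ≤ x - a →
      (s : ℂ) ^ (β - 1) * foxH P L₁ (w * ((s ^ α : ℝ) : ℂ)) = powerKernel ν G e s := by
    intro s hs hsD
    rw [foxH, ← mbIntegral_congr_indented hind,
      hmb _ ((converges_congr_indented hind _).2 (hconv s ⟨hs, hsD⟩)), powerKernel,
      ← integral_const_mul]
    refine integral_congr_ae (Filter.Eventually.of_forall fun y => ?_)
    simp only [hG]
    rw [mul_assoc, hpow s hs]
    ring
  obtain ⟨M, hM, hkM⟩ := exists_norm_powerKernel_le heb hD hGi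
  obtain ⟨f1, f2, f3, f4⟩ := fubini_convolution (γ := γ) hμ hb hM hax hs
    (measurable_powerKernel (ν := ν) hGm hem) hkM hφ hφI
  have hopI : ∀ t ∈ Ioo a x, ∀ u ∈ Ioo a t,
      hOpIntegrand P L₁ w α β φ t u = powerKernel ν G e (t - u) * φ u := by
    intro t ht u hu
    rw [hOpIntegrand, hker (t - u) (sub_pos.2 hu.2) (by linarith [hu.1, ht.2])]
  have hop : ∀ t ∈ Ioo a x, hOp P L₁ w α β a φ t =
      ∫ u in Ioo a t, powerKernel ν G e (t - u) * φ u := by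
    intro t ht
    rw [hOp, intervalIntegral.integral_of_le ht.1.le, integral_Ioc_eq_integral_Ioo]
    exact setIntegral_congr_fun measurableSet_Ioo (hopI t ht)
  have hfrac : ∀ t ∈ Ioo a x, fracIntegrand γ μ (hOp P L₁ w α β a φ) x t =
      (t : ℂ) ^ γ * ((x - t : ℝ) : ℂ) ^ (μ - 1) *
        ∫ u in Ioo a t, powerKernel ν G e (t - u) * φ u := by
    intro t ht
    rw [fracIntegrand, hop t ht, show μ - 1 = -(1 - μ) by ring, Complex.cpow_neg]
    ring
  -- the variable of the hypergeometric function
  have hyne : ∀ u ∈ Ioo a x, (x - u) / x ≠ 0 := fun u hu' =>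
    div_ne_zero (sub_pos.2 hu'.2).ne' hx
  have hsgn : ∀ u ∈ Ioo a x, 0 < u ∨ x < 0 := fun u hu' => hs.imp (fun h => h.trans_lt hu'.1) id
  have hxγ : (x : ℂ) ^ γ ≠ 0 := by
    have : (x : ℂ) ≠ 0 := by exact_mod_cast hx
    simp [Complex.cpow_eq_zero_iff, this]
  have hΓ : Complex.Gamma (-γ) ≠ 0 := Complex.Gamma_ne_zero fun k h => hγ' k (neg_injective h)
  set out : ℝ → ℂ → ℂ := fun u => outerIntegrand (kernelJoint μ β α) (P.consUpper (1 - β) α)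
    (kernelSecond γ μ) L₂ (w * (((x - u) ^ α : ℝ) : ℂ)) ((-((x - u) / x) : ℝ) : ℂ) with hout
  have hCu : ∀ u ∈ Ioo a x, ((x - u : ℝ) : ℂ) ^ (μ + β - 1) ≠ 0 := by
    intro u hu'
    have : ((x - u : ℝ) : ℂ) ≠ 0 := by exact_mod_cast (sub_pos.2 hu'.2).ne'
    rw [Ne, Complex.cpow_eq_zero_iff]
    tauto
  -- by Barnes's and Euler's integrals the outer integrand is the Euler integral times a power
  have houter : ∀ u ∈ Ioo a x, ∀ᵐ y ∂ν, out u (ζ y) =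
      (Complex.Gamma (-γ) / ((x : ℂ) ^ γ * ((x - u : ℝ) : ℂ) ^ (μ + β - 1))) *
      (G₀ y * ((x : ℂ) ^ γ * ((x - u : ℝ) : ℂ) ^ (μ + e y - 1) *
        eulerIntegral γ μ (e y) ((x - u) / x))) := by
    intro u hu'
    filter_upwards [heb] with y hy
    have hd := sub_pos.2 hu'.2
    have hd' : ((x - u : ℝ) : ℂ) ≠ 0 := by exact_mod_cast hd.ne'
    have hB := barnes_mbIntegral (b := e y) hL₂ hL₂loop hμ (hb.trans_le hy) hγ' (hyne u hu')
      (hu u hu')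
    have hCu' := hCu u hu'
    rw [hout]
    simp only
    rw [outerIntegrand, foxIntegrand, theta_consUpper, mul_rpow_cpow hd, innerIntegrand_eq_barnes,
      show μ + β + α * ζ y = μ + e y by simp only [he]; ring,
      show μ + e y - 1 = (μ + β - 1) + α * ζ y by simp only [he]; ring, Complex.cpow_add _ _ hd']
    field_simp
    simp only [hG₀]
    linear_combination (P.theta (ζ y) * w ^ ζ y * ((x - u : ℝ) : ℂ) ^ (α * ζ y)) * hB
  have hcore := fun (H : Y → ℂ) (hHm : Measurable H)
      (hH : Integrable (fun y => H y * ((x - a : ℝ) : ℂ) ^ (e y - 1)) ν) (u : ℝ)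
      (hu' : u ∈ Ioo a x) => integral_powerKernel (γ := γ) hHm hem hμ hb heb hH hu'.2
        (by linarith [hu'.1]) (hsgn u hu') hx (hu u hu')
  have houtc : ∀ u ∈ Ioo a x, L₁.Converges (P.consUpper (1 - β) α).leftPoles (out u) := by
    intro u hu'
    rw [hcv]
    exact ((hcore G₀ hG₀m hG₀i u hu').1.const_mul _).congr
      ((houter u hu').mono fun y hy => hy.symm)
  have hfox : ∀ u ∈ Ioo a x, foxH₂ (kernelJoint μ β α) (P.consUpper (1 - β) α) (kernelSecond γ μ)
      L₁ L₂ (w * (((x - u) ^ α : ℝ) : ℂ)) ((-((x - u) / x) : ℝ) : ℂ) =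
      (Complex.Gamma (-γ) / ((x : ℂ) ^ γ * ((x - u : ℝ) : ℂ) ^ (μ + β - 1))) *
      ∫ t in Ioo u x, (t : ℂ) ^ γ * ((x - t : ℝ) : ℂ) ^ (μ - 1) * powerKernel ν G e (t - u) := by
    intro u hu'
    rw [(hcore G hGm hGi u hu').2, foxH₂, hmb _ (houtc u hu'), ← integral_const_mul]
    refine integral_congr_ae ((houter u hu').mono fun y hy => ?_)
    simp only [hG]
    rw [hy]
    ring
  have hright : ∀ u ∈ Ioo a x, ((x - u : ℝ) : ℂ) ^ (μ + β - 1) *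
      foxH₂ (kernelJoint μ β α) (P.consUpper (1 - β) α) (kernelSecond γ μ) L₁ L₂
        (w * (((x - u) ^ α : ℝ) : ℂ)) ((-((x - u) / x) : ℝ) : ℂ) * φ u =
      (Complex.Gamma (-γ) / (x : ℂ) ^ γ) * (φ u *
      ∫ t in Ioo u x, (t : ℂ) ^ γ * ((x - t : ℝ) : ℂ) ^ (μ - 1) * powerKernel ν G e (t - u)) := by
    intro u hu'
    have hCu' := hCu u hu'
    rw [hfox u hu']
    field_simp
  refine ⟨?_, ?_, fun u hu' => ⟨fun ξ _ => ?_, houtc u hu'⟩, ?_, ?_, ?_⟩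
  · filter_upwards [f1, ae_restrict_mem measurableSet_Ioo] with t ht htm
    exact IntegrableOn.congr_fun ht (fun u hu' => (hopI t htm u hu').symm) measurableSet_Ioo
  · exact IntegrableOn.congr_fun f2 (fun t ht => (hfrac t ht).symm) measurableSet_Ioo
  · obtain ⟨c, T, hcT⟩ := hL₂loop
    rw [innerIntegrand_eq_barnes]
    exact (barnes_loop hL₂ hcT hμ hγ' (by exact_mod_cast neg_ne_zero.2 (hyne u hu'))
      (by rw [Complex.norm_real, Real.norm_eq_abs, abs_neg]; exact hu u hu')).1
  · exact IntegrableOn.congr_fun (f3.const_mul _) (fun u hu' => (hright u hu').symm)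
      measurableSet_Ioo
  · rw [fracI, intervalIntegral.integral_of_le hax.le, intervalIntegral.integral_of_le hax.le,
      integral_Ioc_eq_integral_Ioo, integral_Ioc_eq_integral_Ioo,
      setIntegral_congr_fun measurableSet_Ioo hfrac, setIntegral_congr_fun measurableSet_Ioo hright,
      f4, integral_const_mul]
    field_simp
  · intro u hu' ξ hξ
    rw [integral_eq_eulerIntegral hu'.2 hx (hu u hu'),
      eulerIntegral_eq_hypergeometric γ hμ hξ (hu u hu')]
    simp only [add_assoc, mul_assoc]
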